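/- Let $p\le d$, $\mathsf X=\mathbb R^d$, $\mathsf Y=\mathbb R^p$ with Euclidean norms $|\cdot|$ and Borel $\sigma$-fields. On a probability space with probability $\mathbb P_\star$ and expectation $\mathbb E_\star$, let $$X_k=f(X_{k-1})+\zeta_k\ (k\ge 1),\qquad Y_k=h(X_k)+\varepsilon_k\ (k\ge 0),$$ where $X_0$ is an arbitrary random vector, $(\zeta_k)_{k\ge 0}$ is i.i.d. with an everywhere positive density $\gamma$ with respect to Lebesgue measure on $\mathsf X$, $(\varepsilon_k)_{k\ge 0}$ is i.i.d. with an everywhere positive density $v$ with respect to Lebesgue measure on $\mathsf Y$, and the two noise sequences are independent of each other. For $r>0$ put $\gamma^-(r)=\inf_{|s|\le r}\gamma(s)$ and $\gamma^+(r)=\sup_{|s|\le r}\gamma(s)$, and assume $\gamma^+(r)<\infty$ for all $r$. Let $$Q(x,A)=\int_A\gamma(x'-f(x))\,dx',\qquad g(x,y)=v(y-h(x)),$$ and, for a probability measure $\nu$ on $\mathsf X$ and $y_0,\dots,y_n\in\mathsf Y$, let the filtering distribution be $$\phi_{\nu,n}[y_{0:n}](A)=\frac{\int \nu(dx_0)g(x_0,y_0)\prod_{i=1}^nQ(x_{i-1},dx_i)g(x_i,y_i)\,\mathbb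 1_A(x_n)}{\int \nu(dx_0)g(x_0,y_0)\prod_{i=1}^nQ(x_{i-1},dx_i)g(x_i,y_i)} .$$ Assume, for constants $a,b_0,b$: (E1) $|f(x)-f(x')|\le a|x-x'|$ for all $x,x'$; $h$ is uniformly continuous and surjective; and $|x_1-x_2|\le b_0+b|y_1-y_2|$ whenever $h(x_1)=y_1$ and $h(x_2)=y_2$. (E2) $v$ is bounded, $\lim_{|u|\to\infty}v(u)=0$, and $\inf_{K}v>0$ for every nonempty compact $K\subset\mathsf Y$. For $\Delta>0$ let $\mathsf C(y,\Delta)=\{x\in\mathsf X:|h(x)-y|\le\Delta\}$ and, for $k\ge1$, $$Z_k^\Delta=-\log\gamma^-\big(2(a+1)b_0+(a+1)b\Delta+ab|\varepsilon_{k-1}|+|\zeta_k|+b|\varepsilon_k|\big)$$ (equal to $+\infty$ where $\gamma^-$ vanishes). Assume that for every $\Delta>0$ there is $\tau>0$ such that the log-moment generating function $\psi_{Z_1^\Delta}(\lambda)=\log\mathbb E_\star[e^{\lambda Z_1^\Delta}]$ is finite for all $\lambda\in[0,\tau)$. Let $\nu,\nu'$ be probability measures on $\mathsf X$ and $\Delta>0$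 be such that for some $\lambda>0$ $$\mathbb E_\star\Big\{\exp\Big(\lambda\Big[\log\int\nu(dx)\,g(x,Y_0)\,Q(x,\mathsf C(Y_1,\Delta))\Big]_-\Big)\Big\}<\infty,\qquad \mathbb E_\star\Big\{\exp\Big(\lambda\Big[\log\int\nu'(dx)\,g(x,Y_0)\,Q(x,\mathsf C(Y_1,\Delta))\Big]_-\Big)\Big\}<\infty,$$ where $[t]_-=\max(-t,0)$. Then $$\limsup_{n\to\infty}\ \frac1n\log\mathbb E_\star\big[\|\phi_{\nu,n}[Y_{0:n}]-\phi_{\nu',n}[Y_{0:n}]\|_{\mathrm{TV}}\big]<0,$$ where $\|\cdot\|_{\mathrm{TV}}$ is the total variation norm and $\log 0=-\infty$. -/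

import Mathlib

open MeasureTheory ProbabilityTheory Filter Topology

noncomputable section

/-! ### Total variation and filtering distributions of a hidden Markov model -/

section Filtering

variable {S T : Type*} [MeasurableSpace S] [MeasurableSpace T]

/-- The measure `m` divided by its total mass. -/
def normalizedMeasure (m : Measure S) : Measure S := (m Set.univ)⁻¹ • m

instance instIsFiniteMeasureNormalizedMeasure (m : Measure S) :
    IsFiniteMeasure (normalizedMeasure m) := by
  constructor
  simp only [normalizedMeasure, Measure.smul_apply, smul_eq_mul]
  exact lt_of_le_of_lt (ENNReal.inv_mul_le_one _) ENNReal.one_lt_top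

/-- The total variation norm `‖m₁ - m₂‖_TV` of the difference of two finite measures. -/
def tvNorm (m₁ m₂ : Measure S) [IsFiniteMeasure m₁] [IsFiniteMeasure m₂] : ENNReal :=
  (m₁.toSignedMeasure - m₂.toSignedMeasure).totalVariation Set.univ

/-- The unnormalized filtering measure
`A ↦ ν[g(·, y₀) Q g(·, y₁) Q ⋯ Q g(·, yₙ) 𝟙_A]`, for the transition kernel `Q` of the hidden
chain and the likelihood `g`. It depends only on `y₀, …, yₙ`. -/
def unnormalizedFilter (Q : Kernel S S) (g : S → T → ℝ) (ν : Measure S) (y : ℕ → T) :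
    ℕ → Measure S
  | 0 => ν.withDensity fun x => ENNReal.ofReal (g x (y 0))
  | n + 1 =>
      ((unnormalizedFilter Q g ν y n).bind Q).withDensity fun x => ENNReal.ofReal (g x (y (n + 1)))

/-- The filtering distribution `φ_{ν,n}[y_{0:n}]`. -/
def filterDist (Q : Kernel S S) (g : S → T → ℝ) (ν : Measure S) (y : ℕ → T) (n : ℕ) : Measure S :=
  normalizedMeasure (unnormalizedFilter Q g ν y n)

instance instIsFiniteMeasureFilterDist (Q : Kernel S S) (g : S → T → ℝ) (ν : Measure S)
    (y : ℕ → T) (n : ℕ) : IsFiniteMeasure (filterDist Q g ν y n) :=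
  instIsFiniteMeasureNormalizedMeasure _

end Filtering

/-- The log-moment generating function `ψ_Z(lam) = log E[exp(lam Z)]` of an extended real random
variable; it is `⊤` where the expectation is infinite. -/
def logMGF {Ω : Type*} [MeasurableSpace Ω] (P : Measure Ω) (Z : Ω → EReal) (lam : ℝ) : EReal :=
  ENNReal.log (∫⁻ ω, EReal.exp ((lam : EReal) * Z ω) ∂P)

/-! ### The nonlinear state-space model `X_k = f(X_{k-1}) + ζ_k`, `Y_k = h(X_k) + ε_k` -/

section StateSpace

variable {d p : ℕ}

/-- The state kernel `Q(x, A) = ∫_A γ(x' - f(x)) dx'`. -/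
def stateKernel (f : EuclideanSpace ℝ (Fin d) → EuclideanSpace ℝ (Fin d))
    (γ : EuclideanSpace ℝ (Fin d) → ℝ) :
    Kernel (EuclideanSpace ℝ (Fin d)) (EuclideanSpace ℝ (Fin d)) :=
  Kernel.withDensity (Kernel.const _ volume) fun x x' => ENNReal.ofReal (γ (x' - f x))

/-- The likelihood `g(x, y) = v(y - h(x))`. -/
def likelihood (h : EuclideanSpace ℝ (Fin d) → EuclideanSpace ℝ (Fin p))
    (v : EuclideanSpace ℝ (Fin p) → ℝ)
    (x : EuclideanSpace ℝ (Fin d)) (y : EuclideanSpace ℝ (Fin p)) : ℝ :=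
  v (y - h x)

/-- The set `C(y, Δ) = {x : |h(x) - y| ≤ Δ}`. -/
def ldSet (h : EuclideanSpace ℝ (Fin d) → EuclideanSpace ℝ (Fin p))
    (y : EuclideanSpace ℝ (Fin p)) (Δ : ℝ) : Set (EuclideanSpace ℝ (Fin d)) :=
  {x | ‖h x - y‖ ≤ Δ}

/-- `γ⁻(r) = inf_{|s| ≤ r} γ(s)`, as an element of `[0, ∞]`. -/
def gammaMinus (γ : EuclideanSpace ℝ (Fin d) → ℝ) (r : ℝ) : ENNReal :=
  ⨅ s ∈ Metric.closedBall (0 : EuclideanSpace ℝ (Fin d)) r, ENNReal.ofReal (γ s)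

/-- `γ⁺(r) = sup_{|s| ≤ r} γ(s)`, as an element of `[0, ∞]`. -/
def gammaPlus (γ : EuclideanSpace ℝ (Fin d) → ℝ) (r : ℝ) : ENNReal :=
  ⨆ s ∈ Metric.closedBall (0 : EuclideanSpace ℝ (Fin d)) r, ENNReal.ofReal (γ s)

/-- Assumption (E1): `f` is `a`-Lipschitz, `h` is uniformly continuous and surjective, and two
states are at most `b₀ + b |y₁ - y₂|` apart when they lie in the preimages of `y₁` and `y₂`. -/
structure AssumptionE1 (f : EuclideanSpace ℝ (Fin d) → EuclideanSpace ℝ (Fin d))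
    (h : EuclideanSpace ℝ (Fin d) → EuclideanSpace ℝ (Fin p)) (a b₀ b : ℝ) : Prop where
  lipschitz : ∀ x x', ‖f x - f x'‖ ≤ a * ‖x - x'‖
  uniformContinuous : UniformContinuous h
  surjective : Function.Surjective h
  preimage_dist : ∀ y₁ y₂ x₁ x₂, h x₁ = y₁ → h x₂ = y₂ → ‖x₁ - x₂‖ ≤ b₀ + b * ‖y₁ - y₂‖

/-- Assumption (E2): `v` is bounded, tends to `0` at infinity, and is bounded away from `0` on
every compact set. -/
structure AssumptionE2 (v : EuclideanSpace ℝ (Fin p) → ℝ) : Prop where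
  bounded : ∃ M, ∀ u, v u ≤ M
  tendsto_zero : Tendsto v (cocompact (EuclideanSpace ℝ (Fin p))) (𝓝 0)
  compact_pos : ∀ K : Set (EuclideanSpace ℝ (Fin p)), IsCompact K → ∃ c > 0, ∀ u ∈ K, c ≤ v u

/-- `ξ₀, ξ₁, …` are i.i.d. random vectors with the everywhere positive density `q` with respect
to Lebesgue measure. -/
structure IsIIDWithPosDensity {Ω : Type*} [MeasurableSpace Ω] (P : Measure Ω)
    (ξ : ℕ → Ω → EuclideanSpace ℝ (Fin d)) (q : EuclideanSpace ℝ (Fin d) → ℝ) : Prop where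
  measurable_density : Measurable q
  density_pos : ∀ u, 0 < q u
  measurable : ∀ k, Measurable (ξ k)
  law : ∀ k, P.map (ξ k) = volume.withDensity fun u => ENNReal.ofReal (q u)
  indep : iIndepFun ξ P

/-- The process `(X, Y)` is produced by the state-space equations
`X_k = f(X_{k-1}) + ζ_k` (`k ≥ 1`) and `Y_k = h(X_k) + ε_k` (`k ≥ 0`) with i.i.d. state noise `ζ`
of positive density `γ`, and i.i.d. observation noise `ε` of positive density `v`, the two noise
sequences being independent of each other. -/
structure IsStateSpaceProcess {Ω : Type*} [MeasurableSpace Ω] (P : Measure Ω)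
    (f : EuclideanSpace ℝ (Fin d) → EuclideanSpace ℝ (Fin d))
    (h : EuclideanSpace ℝ (Fin d) → EuclideanSpace ℝ (Fin p))
    (γ : EuclideanSpace ℝ (Fin d) → ℝ) (v : EuclideanSpace ℝ (Fin p) → ℝ)
    (ζ : ℕ → Ω → EuclideanSpace ℝ (Fin d)) (ε : ℕ → Ω → EuclideanSpace ℝ (Fin p))
    (X : ℕ → Ω → EuclideanSpace ℝ (Fin d)) (Y : ℕ → Ω → EuclideanSpace ℝ (Fin p)) : Prop where
  state_noise : IsIIDWithPosDensity P ζ γ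
  obs_noise : IsIIDWithPosDensity P ε v
  indep_noise : IndepFun (fun ω k => ζ k ω) (fun ω k => ε k ω) P
  measurable_init : Measurable (X 0)
  state_eq : ∀ k ω, X (k + 1) ω = f (X k ω) + ζ (k + 1) ω
  obs_eq : ∀ k ω, Y k ω = h (X k ω) + ε k ω

/-- `Z_k^Δ = -log γ⁻(2(a+1)b₀ + (a+1)bΔ + ab|ε_{k-1}| + |ζ_k| + b|ε_k|)` for `k ≥ 1`; it is `⊤`
where `γ⁻` vanishes. -/
def noiseZ {Ω : Type*} (γ : EuclideanSpace ℝ (Fin d) → ℝ) (a b₀ b : ℝ)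
    (ζ : ℕ → Ω → EuclideanSpace ℝ (Fin d)) (ε : ℕ → Ω → EuclideanSpace ℝ (Fin p))
    (Δ : ℝ) (k : ℕ) (ω : Ω) : EReal :=
  -ENNReal.log (gammaMinus γ (2 * (a + 1) * b₀ + (a + 1) * b * Δ
    + a * b * ‖ε (k - 1) ω‖ + ‖ζ k ω‖ + b * ‖ε k ω‖))

/-- `ν g(·, y) Q 𝟙_{C(y', Δ)} = ∫ g(x, y) Q(x, C(y', Δ)) ν(dx)`. -/
def initMass (f : EuclideanSpace ℝ (Fin d) → EuclideanSpace ℝ (Fin d))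
    (h : EuclideanSpace ℝ (Fin d) → EuclideanSpace ℝ (Fin p))
    (γ : EuclideanSpace ℝ (Fin d) → ℝ) (v : EuclideanSpace ℝ (Fin p) → ℝ) (Δ : ℝ)
    (ν : Measure (EuclideanSpace ℝ (Fin d))) (y y' : EuclideanSpace ℝ (Fin p)) : ENNReal :=
  ∫⁻ x, ENNReal.ofReal (likelihood h v x y) * stateKernel f γ x (ldSet h y' Δ) ∂ν

/-- `E[exp(lam [log w]₋)]` for a `[0, ∞]`-valued random variable `w`, where `[t]₋ = max(-t, 0)`. -/
def expNegLogMoment {Ω : Type*} [MeasurableSpace Ω] (P : Measure Ω) (w : Ω → ENNReal)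
    (lam : ℝ) : ENNReal :=
  ∫⁻ ω, EReal.exp ((lam : EReal) * max (-ENNReal.log (w ω)) 0) ∂P

end StateSpace

end

/-!
Two copies of the hidden chain, started from `ν` and `ν'` and weighted by the likelihood of the same
observations, carry the measures `μₙ ⊗ μₙ'` and `μₙ' ⊗ μₙ`, where `μₙ`, `μₙ'` are the unnormalized
filters. The total variation distance of the filters is controlled by the difference of these two
measures, divided by `μₙ(𝖷) μₙ'(𝖷)`. That difference is antisymmetric under the exchange of the two
copies, so it gives no mass to the symmetric set `C × C`, `C = C(Yₖ, Δ')`. A move from `C × C` to the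
next such set has a transition density between `γ⁻(R)²` and `γ⁺(R)²`, where the radius `R` depends
only on the noise of the model; the constant part `γ⁻(R)²` of this density acts equally on
both orders and cancels (`propagate_pairKernel_add_residual`). Hence each such move contracts the
difference by a factor smaller than `1`, except for the rare times when `γ⁻(R) / γ⁺(R)` is
tiny.

Pairs outside `C × C` are not contracted, but there the likelihood of one of the copies is at most
`sup_{|u| > Δ'} v`, which can be made as small as one likes. Charging a factor `t ^ s` to each
bad pair repays the contraction lost around it (`pow_mul_propagate_residual_le`), and
Hölder's inequality bounds the flow with charge `t ^ s` by the flow without charge to the power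
`1 - s` and the flow with charge `t` to the power `s`; the last one is bounded by a constant to the
power `n` if `t` is at most the inverse of the likelihood outside (`pow_mul_lintegral_residual_le`).
After division by the normalizing constants, only the `s`-th power of
`constⁿ / (μₙ(𝖷) μₙ'(𝖷))` remains, against a contraction of order `t ^ (-s n / 4)` when half of the
moves contract. The ratio is at most `Lⁿ` for some `L` that depends on the given `Δ` only
(`le_unnormalizedFilter_succ`), so it suffices to choose `Δ'`, and thus `t = L ^ 8`, after `L`, and
then `s` small enough for the Doeblin constants of `C(·, Δ')`
(`tvNorm_filterDist_le_of_good`).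

What remains is to bound the probability of the exceptional events: the initial masses or the
products of `γ⁻` are exponentially small, or the Doeblin constant is bad at a fixed proportion of
the times. The blocks `(ε_{k-1}, ζ_k, ε_k)` with `k` of a given parity are independent, and Markov's
inequality applied to products over each parity class gives exponential bounds
(`measure_le_prod_noiseBlock_le`). On the exceptional events the distance is at most `2`.
-/

open scoped ENNReal

/-! ### Weighted flows of densities -/

section Propagate

variable {T : Type*} [MeasurableSpace T]

/-- The density at time `n` of the unnormalized flow with initial density `w 0 * ψ`, transition
density `k n` from time `n` to time `n + 1` with respect to `Λ`, and weight `w n` at time `n`. -/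
noncomputable def propagate (Λ : Measure T) (k : ℕ → T → T → ℝ≥0∞) (w : ℕ → T → ℝ≥0∞)
    (ψ : T → ℝ≥0∞) : ℕ → T → ℝ≥0∞
  | 0 => fun z => w 0 z * ψ z
  | n + 1 => fun z' => w (n + 1) z' * ∫⁻ z, k n z z' * propagate Λ k w ψ n z ∂Λ

variable {Λ : Measure T} {k : ℕ → T → T → ℝ≥0∞} {w : ℕ → T → ℝ≥0∞} {ψ : T → ℝ≥0∞}

lemma measurable_propagate [SFinite Λ] (hk : ∀ n, Measurable (Function.uncurry (k n)))
    (hw : ∀ n, Measurable (w n)) (hψ : Measurable ψ) (n : ℕ) :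
    Measurable (propagate Λ k w ψ n) := by
  induction n with
  | zero => exact (hw 0).mul hψ
  | succ n ih =>
    refine (hw (n + 1)).mul ?_
    refine Measurable.lintegral_prod_right' (f := fun u : T × T => k n u.2 u.1 *
      propagate Λ k w ψ n u.2) ?_
    exact ((hk n).comp measurable_swap).mul (ih.comp measurable_snd)

/-- Hölder's inequality along the flow. -/
lemma propagate_le_rpow_mul_rpow [SFinite Λ] (hk : ∀ n, Measurable (Function.uncurry (k n)))
    {w₁ w₂ : ℕ → T → ℝ≥0∞} (hw₁ : ∀ n, Measurable (w₁ n)) (hw₂ : ∀ n, Measurable (w₂ n))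
    (hψ : Measurable ψ) {s : ℝ} (hs₀ : 0 ≤ s) (hs₁ : s ≤ 1)
    (hw : ∀ n z, w n z ≤ w₁ n z ^ (1 - s) * w₂ n z ^ s) (n : ℕ) (z : T) :
    propagate Λ k w ψ n z ≤
      propagate Λ k w₁ ψ n z ^ (1 - s) * propagate Λ k w₂ ψ n z ^ s := by
  have hs' : 0 ≤ 1 - s := by linarith
  have hsplit : ∀ x : ℝ≥0∞, x = x ^ (1 - s) * x ^ s := fun x => by
    rw [← ENNReal.rpow_add_of_nonneg _ _ hs' hs₀]; simp
  induction n generalizing z with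
  | zero =>
    simp only [propagate]
    rw [ENNReal.mul_rpow_of_nonneg _ _ hs', ENNReal.mul_rpow_of_nonneg _ _ hs₀,
      mul_mul_mul_comm, ← hsplit]
    gcongr
    exact hw 0 z
  | succ n ih =>
    simp only [propagate]
    rw [ENNReal.mul_rpow_of_nonneg _ _ hs', ENNReal.mul_rpow_of_nonneg _ _ hs₀,
      mul_mul_mul_comm]
    refine mul_le_mul' (hw _ z) ?_
    have hkz : Measurable fun z₀ => k n z₀ z :=
      (hk n).comp (measurable_id.prodMk measurable_const)
    calc ∫⁻ z₀, k n z₀ z * propagate Λ k w ψ n z₀ ∂Λ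
        ≤ ∫⁻ z₀, (k n z₀ z * propagate Λ k w₁ ψ n z₀) ^ (1 - s) *
            (k n z₀ z * propagate Λ k w₂ ψ n z₀) ^ s ∂Λ := by
          refine lintegral_mono fun z₀ => ?_
          simp only
          rw [ENNReal.mul_rpow_of_nonneg _ _ hs', ENNReal.mul_rpow_of_nonneg _ _ hs₀,
            mul_mul_mul_comm, ← hsplit]
          gcongr
          exact ih z₀
      _ ≤ _ := ENNReal.lintegral_mul_norm_pow_le
          (hkz.mul (measurable_propagate hk hw₁ hψ n)).aemeasurable
          (hkz.mul (measurable_propagate hk hw₂ hψ n)).aemeasurable hs' hs₀ (by ring)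

lemma lintegral_propagate_le [SFinite Λ] (hk : ∀ n, Measurable (Function.uncurry (k n)))
    (hk₁ : ∀ n z, ∫⁻ z', k n z z' ∂Λ ≤ 1)
    (hw : ∀ n, Measurable (w n)) (hψ : Measurable ψ) {B : ℝ≥0∞} (hB : ∀ n z, w n z ≤ B) (n : ℕ) :
    ∫⁻ z, propagate Λ k w ψ n z ∂Λ ≤ B ^ (n + 1) * ∫⁻ z, ψ z ∂Λ := by
  induction n with
  | zero =>
    simp only [propagate, zero_add, pow_one]
    rw [← lintegral_const_mul _ hψ]
    exact lintegral_mono fun z => mul_le_mul_left (hB 0 z) _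
  | succ n ih =>
    have hp := measurable_propagate (Λ := Λ) hk hw hψ n
    have hm : Measurable (Function.uncurry fun z z' => k n z z' * propagate Λ k w ψ n z) :=
      (hk n).mul (hp.comp measurable_fst)
    calc ∫⁻ z, propagate Λ k w ψ (n + 1) z ∂Λ
        ≤ ∫⁻ z', B * ∫⁻ z, k n z z' * propagate Λ k w ψ n z ∂Λ ∂Λ :=
          lintegral_mono fun z => mul_le_mul_left (hB _ z) _
      _ = B * ∫⁻ z, ∫⁻ z', k n z z' * propagate Λ k w ψ n z ∂Λ ∂Λ := by
          have hm' : Measurable fun z' => ∫⁻ z, k n z z' * propagate Λ k w ψ n z ∂Λ :=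
            hm.lintegral_prod_left'
          rw [lintegral_const_mul _ hm', lintegral_lintegral_swap hm.aemeasurable]
      _ ≤ B * ∫⁻ z, propagate Λ k w ψ n z ∂Λ := by
          gcongr with z
          rw [lintegral_mul_const _ ((hk n).of_uncurry_left)]
          exact mul_le_of_le_one_left zero_le (hk₁ n z)
      _ ≤ B * (B ^ (n + 1) * ∫⁻ z, ψ z ∂Λ) := by gcongr
      _ = _ := by rw [← mul_assoc, ← pow_succ']

lemma propagate_mono {k' : ℕ → T → T → ℝ≥0∞} (hk : ∀ n z z', k n z z' ≤ k' n z z') (n : ℕ) (z : T) :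
    propagate Λ k w ψ n z ≤ propagate Λ k' w ψ n z := by
  induction n generalizing z with
  | zero => exact le_rfl
  | succ n ih =>
    refine mul_le_mul_right (lintegral_mono fun z₀ => ?_) _
    exact mul_le_mul' (hk _ _ _) (ih z₀)

end Propagate

/-! ### Pairs of flows -/

section Pair

variable {S : Type*} [MeasurableSpace S] {Λ : Measure S}

/-- The tensor square of a transition density. -/
noncomputable def pairKernel (q : S → S → ℝ≥0∞) (z z' : S × S) : ℝ≥0∞ := q z.1 z'.1 * q z.2 z'.2

/-- The tensor product of two functions. -/
noncomputable def tensor (φ φ' : S → ℝ≥0∞) (z : S × S) : ℝ≥0∞ := φ z.1 * φ' z.2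

lemma measurable_pairKernel {q : S → S → ℝ≥0∞} (hq : Measurable (Function.uncurry q)) :
    Measurable (Function.uncurry (pairKernel q)) := by
  have h1 : Measurable fun u : (S × S) × (S × S) => (u.1.1, u.2.1) := by fun_prop
  have h2 : Measurable fun u : (S × S) × (S × S) => (u.1.2, u.2.2) := by fun_prop
  exact (hq.comp h1).mul (hq.comp h2)

lemma measurable_tensor {φ φ' : S → ℝ≥0∞} (hφ : Measurable φ) (hφ' : Measurable φ') :
    Measurable (tensor φ φ') :=
  (hφ.comp measurable_fst).mul (hφ'.comp measurable_snd)

lemma lintegral_tensor [SFinite Λ] {φ φ' : S → ℝ≥0∞} (hφ : Measurable φ) (hφ' : Measurable φ') :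
    ∫⁻ z, tensor φ φ' z ∂(Λ.prod Λ) = (∫⁻ x, φ x ∂Λ) * ∫⁻ x, φ' x ∂Λ :=
  lintegral_prod_mul hφ.aemeasurable hφ'.aemeasurable

variable {q : S → S → ℝ≥0∞} {g : ℕ → S → ℝ≥0∞} {ψ ψ' : S → ℝ≥0∞}

lemma propagate_pairKernel [SFinite Λ] (hq : Measurable (Function.uncurry q))
    (hg : ∀ n, Measurable (g n)) (hψ : Measurable ψ) (hψ' : Measurable ψ') (n : ℕ) (z : S × S) :
    propagate (Λ.prod Λ) (fun _ => pairKernel q) (fun n => tensor (g n) (g n)) (tensor ψ ψ') n z =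
      tensor (propagate Λ (fun _ => q) g ψ n) (propagate Λ (fun _ => q) g ψ' n) z := by
  induction n generalizing z with
  | zero => simp only [propagate, tensor]; ring
  | succ n ih =>
    simp only [propagate, ih]
    have hx : ∀ x', Measurable fun x => q x x' := fun x' =>
      hq.comp (measurable_id.prodMk measurable_const)
    have h1 : Measurable fun x => q x z.1 * propagate Λ (fun _ => q) g ψ n x :=
      (hx z.1).mul (measurable_propagate (Λ := Λ) (fun _ => hq) hg hψ n)
    have h2 : Measurable fun x => q x z.2 * propagate Λ (fun _ => q) g ψ' n x :=
      (hx z.2).mul (measurable_propagate (Λ := Λ) (fun _ => hq) hg hψ' n)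
    have : ∀ z₀ : S × S, pairKernel q z₀ z * tensor (propagate Λ (fun _ => q) g ψ n)
        (propagate Λ (fun _ => q) g ψ' n) z₀ =
        tensor (fun x => q x z.1 * propagate Λ (fun _ => q) g ψ n x)
          (fun x => q x z.2 * propagate Λ (fun _ => q) g ψ' n x) z₀ := fun z₀ => by
      simp only [pairKernel, tensor]; ring
    simp_rw [this]
    rw [lintegral_tensor h1 h2]
    simp only [tensor]
    ring

lemma propagate_swap [SFinite Λ] {k : ℕ → S × S → S × S → ℝ≥0∞} {w : ℕ → S × S → ℝ≥0∞}
    {φ : S × S → ℝ≥0∞} (hk : ∀ n z z', k n z.swap z'.swap = k n z z')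
    (hw : ∀ n z, w n z.swap = w n z) (n : ℕ) (z : S × S) :
    propagate (Λ.prod Λ) k w (fun z => φ z.swap) n z =
      propagate (Λ.prod Λ) k w φ n z.swap := by
  induction n generalizing z with
  | zero => simp only [propagate, hw]
  | succ n ih =>
    simp only [propagate, hw, ih]
    congr 1
    rw [← lintegral_prod_swap]
    refine lintegral_congr fun z₀ => ?_
    rw [Prod.swap_swap, ← hk, Prod.swap_swap]

end Pair

/-! ### Coupling by a local Doeblin condition -/

section Coupling

variable {S : Type*} [MeasurableSpace S] {Λ : Measure S}

/-- The part of the minorizing constant `κ` seen by the pair `(z, z')`: it is `κ` when `z` lies in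
`C ×ˢ C` and `z'` in `C' ×ˢ C'`, and `0` otherwise. -/
noncomputable def commonPart (C C' : Set S) (κ : ℝ≥0∞) (z z' : S × S) : ℝ≥0∞ :=
  (C ×ˢ C).indicator 1 z * ((C' ×ˢ C').indicator 1 z' * κ)

/-- The pair transition density with the common part of the moves from `C n ×ˢ C n` to
`C (n + 1) ×ˢ C (n + 1)` removed. -/
noncomputable def residualKernel (q : S → S → ℝ≥0∞) (C : ℕ → Set S) (κ : ℕ → ℝ≥0∞) (n : ℕ)
    (z z' : S × S) : ℝ≥0∞ :=
  pairKernel q z z' - commonPart (C n) (C (n + 1)) (κ n) z z'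

/-- The indicator, as an exponent, of the pairs outside `C ×ˢ C`. -/
noncomputable def badPair (C : Set S) (z : S × S) : ℕ := ((C ×ˢ C)ᶜ).indicator 1 z

omit [MeasurableSpace S] in
lemma indicator_prod_self_swap (C : Set S) (z : S × S) :
    (C ×ˢ C).indicator (1 : S × S → ℝ≥0∞) z.swap = (C ×ˢ C).indicator 1 z := by
  rcases z with ⟨x, y⟩
  have : (y, x) ∈ C ×ˢ C ↔ (x, y) ∈ C ×ˢ C := by simp [and_comm]
  by_cases hz : (x, y) ∈ C ×ˢ C
  · rw [Prod.swap_prod_mk, Set.indicator_of_mem hz, Set.indicator_of_mem (this.2 hz)]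
    rfl
  · rw [Prod.swap_prod_mk, Set.indicator_of_notMem hz, Set.indicator_of_notMem (this.not.2 hz)]

omit [MeasurableSpace S] in
lemma commonPart_swap (C C' : Set S) (κ : ℝ≥0∞) (z z' : S × S) :
    commonPart C C' κ z.swap z'.swap = commonPart C C' κ z z' := by
  simp only [commonPart, indicator_prod_self_swap]

omit [MeasurableSpace S] in
lemma residualKernel_swap (q : S → S → ℝ≥0∞) (C : ℕ → Set S) (κ : ℕ → ℝ≥0∞) (n : ℕ)
    (z z' : S × S) : residualKernel q C κ n z.swap z'.swap = residualKernel q C κ n z z' := by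
  simp only [residualKernel, commonPart_swap, pairKernel, Prod.fst_swap, Prod.snd_swap, mul_comm]

lemma measurable_indicator_one {T : Type*} [MeasurableSpace T] {A : Set T} (hA : MeasurableSet A) :
    Measurable (A.indicator (1 : T → ℝ≥0∞)) :=
  measurable_one.indicator hA

lemma measurable_commonPart {C C' : Set S} (hC : MeasurableSet C) (hC' : MeasurableSet C')
    (κ : ℝ≥0∞) : Measurable (Function.uncurry (commonPart C C' κ)) :=
  ((measurable_indicator_one (hC.prod hC)).comp measurable_fst).mul
    (((measurable_indicator_one (hC'.prod hC')).comp measurable_snd).mul_const κ)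

variable {q : S → S → ℝ≥0∞} {g : ℕ → S → ℝ≥0∞} {ψ ψ' : S → ℝ≥0∞} {C : ℕ → Set S}
  {κ : ℕ → ℝ≥0∞}

lemma measurable_residualKernel (hq : Measurable (Function.uncurry q))
    (hC : ∀ n, MeasurableSet (C n)) (n : ℕ) :
    Measurable (Function.uncurry (residualKernel q C κ n)) :=
  (measurable_pairKernel hq).sub (measurable_commonPart (hC n) (hC (n + 1)) (κ n))

omit [MeasurableSpace S] in
lemma commonPart_le_pairKernel (hκ : ∀ n, ∀ z ∈ C n ×ˢ C n, ∀ z' ∈ C (n + 1) ×ˢ C (n + 1),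
    κ n ≤ pairKernel q z z') (n : ℕ) (z z' : S × S) :
    commonPart (C n) (C (n + 1)) (κ n) z z' ≤ pairKernel q z z' := by
  classical
  by_cases hz : z ∈ C n ×ˢ C n <;> by_cases hz' : z' ∈ C (n + 1) ×ˢ C (n + 1) <;>
    simp only [commonPart, Set.indicator_of_mem, Set.indicator_of_notMem, hz, hz',
      not_false_eq_true, Pi.one_apply, one_mul, zero_mul, zero_le]
  exact hκ n z hz z' hz'

/-- The product measures of the two flows, in either order, differ by the residual flow and its
swap: the common part moves equal masses to the same place, because it only sees the mass of the
symmetric set `C n ×ˢ C n`. -/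
lemma propagate_pairKernel_add_residual [SFinite Λ] (hq : Measurable (Function.uncurry q))
    (hq₁ : ∀ x, ∫⁻ x', q x x' ∂Λ ≤ 1) (hg : ∀ n, Measurable (g n)) {B : ℝ≥0∞} (hB : B ≠ ⊤)
    (hgB : ∀ n x, g n x ≤ B) (hψ : Measurable ψ) (hψ' : Measurable ψ')
    (hψt : ∫⁻ x, ψ x ∂Λ ≠ ⊤) (hψt' : ∫⁻ x, ψ' x ∂Λ ≠ ⊤)
    (hC : ∀ n, MeasurableSet (C n)) (hκt : ∀ n, κ n ≠ ⊤)
    (hκ : ∀ n, ∀ z ∈ C n ×ˢ C n, ∀ z' ∈ C (n + 1) ×ˢ C (n + 1), κ n ≤ pairKernel q z z')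
    (n : ℕ) (z : S × S) :
    tensor (propagate Λ (fun _ => q) g ψ n) (propagate Λ (fun _ => q) g ψ' n) z +
      propagate (Λ.prod Λ) (residualKernel q C κ) (fun n => tensor (g n) (g n)) (tensor ψ ψ') n
        z.swap =
    tensor (propagate Λ (fun _ => q) g ψ' n) (propagate Λ (fun _ => q) g ψ n) z +
      propagate (Λ.prod Λ) (residualKernel q C κ) (fun n => tensor (g n) (g n)) (tensor ψ ψ') n
        z := by
  have hgw : ∀ n (z : S × S), tensor (g n) (g n) z.swap = tensor (g n) (g n) z := fun n z => by
    simp only [tensor, Prod.fst_swap, Prod.snd_swap, mul_comm]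
  have hgm : ∀ n, Measurable (tensor (g n) (g n)) := fun n => measurable_tensor (hg n) (hg n)
  have hswap := propagate_swap (Λ := Λ) (φ := tensor ψ ψ') (residualKernel_swap q C κ) hgw
  simp only [← propagate_pairKernel hq hg hψ hψ', ← propagate_pairKernel hq hg hψ' hψ]
  induction n generalizing z with
  | zero =>
    simp only [propagate, tensor, Prod.fst_swap, Prod.snd_swap]
    ring
  | succ n ih =>
    rw [← hswap]
    set F := propagate (Λ.prod Λ) (fun _ => pairKernel q) (fun n => tensor (g n) (g n))
      (tensor ψ ψ') n with hF
    set F' := propagate (Λ.prod Λ) (fun _ => pairKernel q) (fun n => tensor (g n) (g n))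
      (tensor ψ' ψ) n with hF'
    have hFm : Measurable F := measurable_propagate (fun _ => measurable_pairKernel hq) hgm
      (measurable_tensor hψ hψ') n
    have hFm' : Measurable F' := measurable_propagate (fun _ => measurable_pairKernel hq) hgm
      (measurable_tensor hψ' hψ) n
    set α := propagate (Λ.prod Λ) (residualKernel q C κ) (fun n => tensor (g n) (g n))
      (tensor ψ ψ') n with hα
    have hαm : Measurable α := measurable_propagate (measurable_residualKernel hq hC) hgm
      (measurable_tensor hψ hψ') n
    have hαt : ∫⁻ z, α z ∂(Λ.prod Λ) ≠ ⊤ := by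
      refine ne_top_of_le_ne_top ?_ (lintegral_mono fun z =>
        propagate_mono (k' := fun _ => pairKernel q) (fun n z z' => tsub_le_self) n z)
      simp only [propagate_pairKernel hq hg hψ hψ']
      rw [lintegral_tensor (measurable_propagate (fun _ => hq) hg hψ n)
        (measurable_propagate (fun _ => hq) hg hψ' n)]
      have h1 := lintegral_propagate_le (Λ := Λ) (fun _ => hq) (fun _ => hq₁) hg hψ hgB n
      have h2 := lintegral_propagate_le (Λ := Λ) (fun _ => hq) (fun _ => hq₁) hg hψ' hgB n
      exact ENNReal.mul_ne_top
        (ne_top_of_le_ne_top (ENNReal.mul_ne_top (ENNReal.pow_ne_top hB) hψt) h1)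
        (ne_top_of_le_ne_top (ENNReal.mul_ne_top (ENNReal.pow_ne_top hB) hψt') h2)
    simp only [propagate, ← hF, ← hF', ← hα, hswap]
    rw [← mul_add, ← mul_add]
    congr 1
    have hqz : Measurable fun z₀ => pairKernel q z₀ z :=
      (measurable_pairKernel hq).comp (measurable_id.prodMk measurable_const)
    have hrz : Measurable fun z₀ => residualKernel q C κ n z₀ z :=
      (measurable_residualKernel hq hC n).comp (measurable_id.prodMk measurable_const)
    have hαs : Measurable fun z₀ : S × S => α z₀.swap := hαm.comp measurable_swap
    have hsplit : ∀ z₀, pairKernel q z₀ z =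
        residualKernel q C κ n z₀ z + commonPart (C n) (C (n + 1)) (κ n) z₀ z := fun z₀ =>
      (tsub_add_cancel_of_le (commonPart_le_pairKernel hκ n z₀ z)).symm
    have hcommon : ∫⁻ z₀, commonPart (C n) (C (n + 1)) (κ n) z₀ z * α z₀.swap ∂(Λ.prod Λ) =
        ∫⁻ z₀, commonPart (C n) (C (n + 1)) (κ n) z₀ z * α z₀ ∂(Λ.prod Λ) := by
      rw [← lintegral_prod_swap]
      refine lintegral_congr fun z₀ => ?_
      simp only [commonPart, indicator_prod_self_swap, Prod.swap_swap]
    have hcommon_ne : ∫⁻ z₀, commonPart (C n) (C (n + 1)) (κ n) z₀ z * α z₀ ∂(Λ.prod Λ) ≠ ⊤ := by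
      refine ne_top_of_le_ne_top (ENNReal.mul_ne_top (hκt n) hαt) ?_
      rw [← lintegral_const_mul _ hαm]
      refine lintegral_mono fun z₀ => mul_le_mul_left ?_ _
      have hi : ∀ (A : Set (S × S)) y, A.indicator (1 : S × S → ℝ≥0∞) y ≤ 1 := fun A y =>
        Set.indicator_le_self' (f := (1 : S × S → ℝ≥0∞)) (fun _ _ => zero_le) y
      exact (mul_le_of_le_one_left zero_le (hi _ _)).trans
        (mul_le_of_le_one_left zero_le (hi _ _))
    -- Propagate the induction hypothesis by the full kernel, then split off the common part of the
    -- residual flows; it has the same finite mass on both sides.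
    have key : (∫⁻ z₀, pairKernel q z₀ z * (F z₀ + α z₀.swap) ∂(Λ.prod Λ)) =
        ∫⁻ z₀, pairKernel q z₀ z * (F' z₀ + α z₀) ∂(Λ.prod Λ) :=
      lintegral_congr fun z₀ => by rw [ih z₀]
    simp only [mul_add] at key
    have hqF : Measurable fun z₀ => pairKernel q z₀ z * F z₀ := hqz.mul hFm
    have hqF' : Measurable fun z₀ => pairKernel q z₀ z * F' z₀ := hqz.mul hFm'
    have hrα : Measurable fun z₀ => residualKernel q C κ n z₀ z * α z₀ := hrz.mul hαm
    have hrαs : Measurable fun z₀ => residualKernel q C κ n z₀ z * α z₀.swap := hrz.mul hαs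
    rw [lintegral_add_left hqF, lintegral_add_left hqF'] at key
    have e1 : ∫⁻ z₀, pairKernel q z₀ z * α z₀.swap ∂(Λ.prod Λ) =
        (∫⁻ z₀, residualKernel q C κ n z₀ z * α z₀.swap ∂(Λ.prod Λ)) +
        ∫⁻ z₀, commonPart (C n) (C (n + 1)) (κ n) z₀ z * α z₀ ∂(Λ.prod Λ) := by
      rw [← hcommon, ← lintegral_add_left hrαs]
      exact lintegral_congr fun z₀ => by rw [hsplit, add_mul]
    have e2 : ∫⁻ z₀, pairKernel q z₀ z * α z₀ ∂(Λ.prod Λ) =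
        (∫⁻ z₀, residualKernel q C κ n z₀ z * α z₀ ∂(Λ.prod Λ)) +
        ∫⁻ z₀, commonPart (C n) (C (n + 1)) (κ n) z₀ z * α z₀ ∂(Λ.prod Λ) := by
      rw [← lintegral_add_left hrα]
      exact lintegral_congr fun z₀ => by rw [hsplit, add_mul]
    rw [e1, e2, ← add_assoc, ← add_assoc] at key
    exact (ENNReal.add_left_inj hcommon_ne).1 key

/-- Each counted move multiplies the residual flow by a factor `τ⁻¹`, unless one of its endpoints
is a bad pair; charging `τ²` to every bad pair pays for both moves adjacent to it. -/
lemma pow_mul_propagate_residual_le {τ : ℝ≥0∞} (hτ : 1 ≤ τ) (hτt : τ ≠ ⊤) {c : ℕ → ℕ}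
    (hc : ∀ n, c n ≤ 1)
    (hκc : ∀ n, c n = 1 → ∀ z ∈ C n ×ˢ C n, ∀ z' ∈ C (n + 1) ×ˢ C (n + 1),
      τ * (pairKernel q z z' - κ n) ≤ pairKernel q z z')
    (n : ℕ) (z : S × S) :
    τ ^ ((∑ i ∈ Finset.range n, c i) + badPair (C n) z) *
      propagate (Λ.prod Λ) (residualKernel q C κ) (fun n => tensor (g n) (g n)) (tensor ψ ψ') n z ≤
    propagate (Λ.prod Λ) (fun _ => pairKernel q)
      (fun n z => τ ^ (2 * badPair (C n) z) * tensor (g n) (g n) z) (tensor ψ ψ') n z := by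
  have hstep : ∀ n z₀ z', τ ^ (c n + badPair (C (n + 1)) z') * residualKernel q C κ n z₀ z' ≤
      τ ^ (2 * badPair (C (n + 1)) z') * (τ ^ badPair (C n) z₀ * pairKernel q z₀ z') := by
    intro n z₀ z'
    have hres : residualKernel q C κ n z₀ z' ≤ pairKernel q z₀ z' := tsub_le_self
    by_cases hz' : z' ∈ C (n + 1) ×ˢ C (n + 1)
    · have hb' : badPair (C (n + 1)) z' = 0 := by simp [badPair, hz']
      by_cases hz : z₀ ∈ C n ×ˢ C n
      · have hb : badPair (C n) z₀ = 0 := by simp [badPair, hz]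
        simp only [hb, hb', mul_zero, add_zero, pow_zero, one_mul]
        rcases Nat.le_one_iff_eq_zero_or_eq_one.1 (hc n) with h0 | h1
        · simpa [h0] using hres
        · have : residualKernel q C κ n z₀ z' = pairKernel q z₀ z' - κ n := by
            simp [residualKernel, commonPart, hz, hz']
          rw [h1, pow_one, this]
          exact hκc n h1 z₀ hz z' hz'
      · have hb : badPair (C n) z₀ = 1 := by simp [badPair, hz]
        simp only [hb, hb', mul_zero, add_zero, pow_zero, one_mul]
        exact mul_le_mul' (pow_le_pow_right₀ hτ (hc n)) hres
    · have hb' : badPair (C (n + 1)) z' = 1 := by simp [badPair, hz']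
      rw [hb']
      refine mul_le_mul' (pow_le_pow_right₀ hτ (by have := hc n; omega)) ?_
      exact hres.trans (le_mul_of_one_le_left' (one_le_pow₀ hτ))
  induction n generalizing z with
  | zero =>
    simp only [Finset.range_zero, Finset.sum_empty, zero_add, propagate]
    rw [← mul_assoc]
    gcongr
    omega
  | succ n ih =>
    simp only [propagate]
    rw [Finset.sum_range_succ]
    set α := propagate (Λ.prod Λ) (residualKernel q C κ) (fun n => tensor (g n) (g n))
      (tensor ψ ψ') n
    set H := propagate (Λ.prod Λ) (fun _ => pairKernel q)
      (fun n z => τ ^ (2 * badPair (C n) z) * tensor (g n) (g n) z) (tensor ψ ψ') n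
    set m := ∑ i ∈ Finset.range n, c i
    rw [mul_left_comm, mul_comm (τ ^ (2 * _)) (tensor _ _ z), mul_assoc (tensor _ _ z),
      ← lintegral_const_mul' _ _ (ENNReal.pow_ne_top hτt),
      ← lintegral_const_mul' _ _ (ENNReal.pow_ne_top hτt)]
    refine mul_le_mul_right (lintegral_mono fun z₀ => ?_) _
    calc τ ^ (m + c n + badPair (C (n + 1)) z) * (residualKernel q C κ n z₀ z * α z₀)
        = (τ ^ (c n + badPair (C (n + 1)) z) * residualKernel q C κ n z₀ z) *
            (τ ^ m * α z₀) := by ring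
      _ ≤ τ ^ (2 * badPair (C (n + 1)) z) * (τ ^ badPair (C n) z₀ * pairKernel q z₀ z) *
            (τ ^ m * α z₀) := mul_le_mul_left (hstep n z₀ z) _
      _ = τ ^ (2 * badPair (C (n + 1)) z) * (pairKernel q z₀ z *
            (τ ^ (m + badPair (C n) z₀) * α z₀)) := by ring
      _ ≤ _ := by gcongr; exact ih z₀

/-- Cross-multiplied comparison of the normalized flows. -/
lemma setLIntegral_propagate_mul_le [SFinite Λ] (hq : Measurable (Function.uncurry q))
    (hq₁ : ∀ x, ∫⁻ x', q x x' ∂Λ ≤ 1) (hg : ∀ n, Measurable (g n)) {B : ℝ≥0∞} (hB : B ≠ ⊤)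
    (hgB : ∀ n x, g n x ≤ B) (hψ : Measurable ψ) (hψ' : Measurable ψ')
    (hψt : ∫⁻ x, ψ x ∂Λ ≠ ⊤) (hψt' : ∫⁻ x, ψ' x ∂Λ ≠ ⊤)
    (hC : ∀ n, MeasurableSet (C n)) (hκt : ∀ n, κ n ≠ ⊤)
    (hκ : ∀ n, ∀ z ∈ C n ×ˢ C n, ∀ z' ∈ C (n + 1) ×ˢ C (n + 1), κ n ≤ pairKernel q z z')
    (n : ℕ) (A : Set S) :
    ((∫⁻ x in A, propagate Λ (fun _ => q) g ψ n x ∂Λ) *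
        ∫⁻ x, propagate Λ (fun _ => q) g ψ' n x ∂Λ ≤
      (∫⁻ x in A, propagate Λ (fun _ => q) g ψ' n x ∂Λ) *
        (∫⁻ x, propagate Λ (fun _ => q) g ψ n x ∂Λ) +
      ∫⁻ z, propagate (Λ.prod Λ) (residualKernel q C κ) (fun n => tensor (g n) (g n))
        (tensor ψ ψ') n z ∂(Λ.prod Λ)) ∧
    ((∫⁻ x in A, propagate Λ (fun _ => q) g ψ' n x ∂Λ) *
        ∫⁻ x, propagate Λ (fun _ => q) g ψ n x ∂Λ ≤
      (∫⁻ x in A, propagate Λ (fun _ => q) g ψ n x ∂Λ) *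
        (∫⁻ x, propagate Λ (fun _ => q) g ψ' n x ∂Λ) +
      ∫⁻ z, propagate (Λ.prod Λ) (residualKernel q C κ) (fun n => tensor (g n) (g n))
        (tensor ψ ψ') n z ∂(Λ.prod Λ)) := by
  have hp := measurable_propagate (Λ := Λ) (fun _ => hq) hg hψ n
  have hp' := measurable_propagate (Λ := Λ) (fun _ => hq) hg hψ' n
  have hid := propagate_pairKernel_add_residual hq hq₁ hg hB hgB hψ hψ' hψt hψt' hC hκt hκ n
  set p := propagate Λ (fun _ => q) g ψ n
  set p' := propagate Λ (fun _ => q) g ψ' n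
  set α := propagate (Λ.prod Λ) (residualKernel q C κ) (fun n => tensor (g n) (g n))
        (tensor ψ ψ') n
  have hpp := measurable_tensor hp hp'
  have hpp' := measurable_tensor hp' hp
  have hset : ∀ φ φ' : S → ℝ≥0∞, Measurable φ → Measurable φ' →
      ∫⁻ z, tensor φ φ' z ∂((Λ.restrict A).prod Λ) = (∫⁻ x in A, φ x ∂Λ) * ∫⁻ x, φ' x ∂Λ :=
    fun φ φ' hφ hφ' => lintegral_prod_mul hφ.aemeasurable hφ'.aemeasurable
  have hle : (Λ.restrict A).prod Λ ≤ Λ.prod Λ := by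
    conv_lhs => rw [← Measure.restrict_univ (μ := Λ), Measure.restrict_restrict_of_subset
      (Set.subset_univ A)]
    rw [Measure.prod_restrict]
    exact Measure.restrict_le_self
  have hα : ∫⁻ z, α z.swap ∂((Λ.restrict A).prod Λ) ≤ ∫⁻ z, α z ∂(Λ.prod Λ) := by
    rw [← lintegral_prod_swap (f := α)]
    exact lintegral_mono' hle le_rfl
  have hα' : ∫⁻ z, α z ∂((Λ.restrict A).prod Λ) ≤ ∫⁻ z, α z ∂(Λ.prod Λ) :=
    lintegral_mono' hle le_rfl
  constructor
  · rw [← hset p p' hp hp', ← hset p' p hp' hp]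
    calc _ ≤ ∫⁻ z, (tensor p p' z + α z.swap) ∂((Λ.restrict A).prod Λ) :=
          lintegral_mono fun z => le_self_add
      _ = ∫⁻ z, (tensor p' p z + α z) ∂((Λ.restrict A).prod Λ) := by simp_rw [hid]
      _ = _ := lintegral_add_left hpp' _
      _ ≤ _ := by gcongr
  · rw [← hset p p' hp hp', ← hset p' p hp' hp]
    calc _ ≤ ∫⁻ z, (tensor p' p z + α z) ∂((Λ.restrict A).prod Λ) :=
          lintegral_mono fun z => le_self_add
      _ = ∫⁻ z, (tensor p p' z + α z.swap) ∂((Λ.restrict A).prod Λ) := by simp_rw [hid]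
      _ = _ := lintegral_add_left hpp _
      _ ≤ _ := by gcongr

/-- The mass of the residual flow. Hölder's inequality interpolates between the pair flow itself
and the pair flow in which every bad pair is charged by a large factor `t`, still bounded by `B`
per step because the likelihood is small on bad pairs. -/
lemma pow_mul_lintegral_residual_le [SFinite Λ] (hq : Measurable (Function.uncurry q))
    (hq₁ : ∀ x, ∫⁻ x', q x x' ∂Λ ≤ 1) (hg : ∀ n, Measurable (g n))
    (hψ : Measurable ψ) (hψ' : Measurable ψ') (hC : ∀ n, MeasurableSet (C n))
    {t B : ℝ≥0∞} {s : ℝ} (hs₀ : 0 ≤ s) (hs₁ : s ≤ 1)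
    (htB : ∀ n z, t ^ badPair (C n) z * tensor (g n) (g n) z ≤ B)
    {τ : ℝ≥0∞} (hτ : 1 ≤ τ) (hτt : τ ≠ ⊤) (hτs : τ ^ 2 = t ^ s) {c : ℕ → ℕ} (hc : ∀ n, c n ≤ 1)
    (hκc : ∀ n, c n = 1 → ∀ z ∈ C n ×ˢ C n, ∀ z' ∈ C (n + 1) ×ˢ C (n + 1),
      τ * (pairKernel q z z' - κ n) ≤ pairKernel q z z') (n : ℕ) :
    τ ^ (∑ i ∈ Finset.range n, c i) *
      ∫⁻ z, propagate (Λ.prod Λ) (residualKernel q C κ) (fun n => tensor (g n) (g n))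
        (tensor ψ ψ') n z ∂(Λ.prod Λ) ≤
    ((∫⁻ x, propagate Λ (fun _ => q) g ψ n x ∂Λ) *
      ∫⁻ x, propagate Λ (fun _ => q) g ψ' n x ∂Λ) ^ (1 - s) *
    (B ^ (n + 1) * ((∫⁻ x, ψ x ∂Λ) * ∫⁻ x, ψ' x ∂Λ)) ^ s := by
  have hs' : 0 ≤ 1 - s := by linarith
  have hsplit : ∀ x : ℝ≥0∞, x = x ^ (1 - s) * x ^ s := fun x => by
    rw [← ENNReal.rpow_add_of_nonneg _ _ hs' hs₀]; simp
  have hgm : ∀ n, Measurable (tensor (g n) (g n)) := fun n => measurable_tensor (hg n) (hg n)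
  have hbad : ∀ n, Measurable fun z => t ^ badPair (C n) z := fun n => by
    have : Measurable (badPair (C n)) := measurable_one.indicator ((hC n).prod (hC n)).compl
    exact (measurable_from_top (f := fun j : ℕ => t ^ j)).comp this
  have hw₂ : ∀ n, Measurable fun z => t ^ badPair (C n) z * tensor (g n) (g n) z := fun n =>
    (hbad n).mul (hgm n)
  have hqq := measurable_pairKernel hq
  have hψψ := measurable_tensor hψ hψ'
  have hqq₁ : ∀ z, ∫⁻ z', pairKernel q z z' ∂(Λ.prod Λ) ≤ 1 := fun z => by
    have := lintegral_tensor (Λ := Λ) (hq.of_uncurry_left (x := z.1))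
      (hq.of_uncurry_left (x := z.2))
    exact this.trans_le (mul_le_one' (hq₁ _) (hq₁ _))
  rw [← lintegral_const_mul' _ _ (ENNReal.pow_ne_top hτt)]
  calc _ ≤ ∫⁻ z, propagate (Λ.prod Λ) (fun _ => pairKernel q)
        (fun n z => τ ^ (2 * badPair (C n) z) * tensor (g n) (g n) z) (tensor ψ ψ') n z
          ∂(Λ.prod Λ) := by
        refine lintegral_mono fun z => ?_
        refine le_trans ?_ (pow_mul_propagate_residual_le hτ hτt hc hκc n z)
        gcongr
        omega
    _ ≤ ∫⁻ z, propagate (Λ.prod Λ) (fun _ => pairKernel q) (fun n => tensor (g n) (g n))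
          (tensor ψ ψ') n z ^ (1 - s) *
        propagate (Λ.prod Λ) (fun _ => pairKernel q)
          (fun n z => t ^ badPair (C n) z * tensor (g n) (g n) z) (tensor ψ ψ') n z ^ s
          ∂(Λ.prod Λ) := by
        refine lintegral_mono fun z => propagate_le_rpow_mul_rpow (fun _ => hqq) hgm hw₂ hψψ
          hs₀ hs₁ (fun n z => ?_) n z
        rw [ENNReal.mul_rpow_of_nonneg _ _ hs₀, mul_left_comm, ← hsplit, pow_mul, hτs,
          ← ENNReal.rpow_mul_natCast, ← ENNReal.rpow_natCast, ← ENNReal.rpow_mul, mul_comm s]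
    _ ≤ _ := ENNReal.lintegral_mul_norm_pow_le
          (measurable_propagate (fun _ => hqq) hgm hψψ n).aemeasurable
          (measurable_propagate (fun _ => hqq) hw₂ hψψ n).aemeasurable hs' hs₀ (by ring)
    _ ≤ _ := by
        refine mul_le_mul' (le_of_eq ?_) ?_
        · simp only [propagate_pairKernel hq hg hψ hψ']
          rw [lintegral_tensor (measurable_propagate (fun _ => hq) hg hψ n)
            (measurable_propagate (fun _ => hq) hg hψ' n)]
        · rw [← lintegral_tensor hψ hψ']
          gcongr
          exact lintegral_propagate_le (fun _ => hqq) (fun _ => hqq₁) hw₂ hψψ htB n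

end Coupling

/-! ### Total variation of normalized measures -/

section TotalVariation

variable {S : Type*} [MeasurableSpace S]

lemma tvNorm_le_of_forall (m₁ m₂ : Measure S) [IsFiniteMeasure m₁] [IsFiniteMeasure m₂] {c : ℝ≥0∞}
    (h₁ : ∀ A, m₁ A ≤ m₂ A + c) (h₂ : ∀ A, m₂ A ≤ m₁ A + c) : tvNorm m₁ m₂ ≤ 2 * c := by
  unfold tvNorm
  set s := m₁.toSignedMeasure - m₂.toSignedMeasure with hs
  have happ : ∀ A, MeasurableSet A → s A = m₁.real A - m₂.real A := fun A hA => by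
    rw [hs, Measure.toSignedMeasure_sub_apply hA]
  have hreal : ∀ m m' : Measure S, IsFiniteMeasure m → IsFiniteMeasure m' → ∀ A,
      m A ≤ m' A + c → ENNReal.ofReal (m.real A - m'.real A) ≤ c := by
    intro m m' _ _ A h
    rw [ENNReal.ofReal_sub _ measureReal_nonneg, ofReal_measureReal, ofReal_measureReal]
    exact tsub_le_iff_left.2 h
  obtain ⟨i, hi, hi₁, hi₂, hpos, hneg⟩ := s.toJordanDecomposition_spec
  have e1 : s.toJordanDecomposition.posPart Set.univ ≤ c := by
    rw [hpos, SignedMeasure.toMeasureOfZeroLE_apply _ hi₁ hi MeasurableSet.univ]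
    refine le_trans (le_of_eq ?_) (hreal m₁ m₂ inferInstance inferInstance i (h₁ i))
    rw [← happ i hi, ENNReal.ofReal]
    congr 1
    ext
    have h0 : 0 ≤ s i := by
      exact VectorMeasure.nonneg_of_zero_le_restrict _ hi₁
    simp [Real.coe_toNNReal _ h0]
  have e2 : s.toJordanDecomposition.negPart Set.univ ≤ c := by
    rw [hneg, SignedMeasure.toMeasureOfLEZero_apply _ hi₂ hi.compl MeasurableSet.univ]
    refine le_trans (le_of_eq ?_) (hreal m₂ m₁ inferInstance inferInstance iᶜ (h₂ iᶜ))
    have : m₂.real iᶜ - m₁.real iᶜ = - s iᶜ := by rw [happ _ hi.compl]; ring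
    rw [this, ENNReal.ofReal]
    congr 1
    ext
    have h0 : s iᶜ ≤ 0 := by
      exact VectorMeasure.nonpos_of_restrict_le_zero _ hi₂
    simp [Real.coe_toNNReal _ (neg_nonneg.2 h0)]
  rw [SignedMeasure.totalVariation, Measure.add_apply, two_mul]
  exact add_le_add e1 e2

lemma normalizedMeasure_le_one (m : Measure S) (A : Set S) : normalizedMeasure m A ≤ 1 := by
  refine (measure_mono (Set.subset_univ A)).trans ?_
  simp only [normalizedMeasure, Measure.smul_apply, smul_eq_mul]
  exact ENNReal.inv_mul_le_one _

lemma tvNorm_normalizedMeasure_le_two (m₁ m₂ : Measure S) :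
    tvNorm (normalizedMeasure m₁) (normalizedMeasure m₂) ≤ 2 := by
  refine (tvNorm_le_of_forall _ _ (c := 1) (fun A => ?_) fun A => ?_).trans (by simp)
  · exact (normalizedMeasure_le_one _ _).trans le_add_self
  · exact (normalizedMeasure_le_one _ _).trans le_add_self

lemma tvNorm_normalizedMeasure_le (m₁ m₂ : Measure S) [IsFiniteMeasure m₁] [IsFiniteMeasure m₂]
    (h₁₀ : m₁ Set.univ ≠ 0) (h₂₀ : m₂ Set.univ ≠ 0) {c : ℝ≥0∞}
    (h₁ : ∀ A, m₁ A * m₂ Set.univ ≤ m₂ A * m₁ Set.univ + c)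
    (h₂ : ∀ A, m₂ A * m₁ Set.univ ≤ m₁ A * m₂ Set.univ + c) :
    tvNorm (normalizedMeasure m₁) (normalizedMeasure m₂) ≤
      2 * (c * (m₁ Set.univ * m₂ Set.univ)⁻¹) := by
  have key : ∀ a b m m' : ℝ≥0∞, m ≠ 0 → m ≠ ⊤ → m' ≠ 0 → m' ≠ ⊤ → a * m' ≤ b * m + c →
      m⁻¹ * a ≤ m'⁻¹ * b + c * (m * m')⁻¹ := by
    intro a b m m' h0 ht h0' ht' hle
    calc m⁻¹ * a = (m * m')⁻¹ * (a * m') := by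
          rw [ENNReal.mul_inv (Or.inl h0) (Or.inl ht), mul_assoc, mul_left_comm m'⁻¹,
            ENNReal.inv_mul_cancel h0' ht', mul_one]
      _ ≤ (m * m')⁻¹ * (b * m + c) := by gcongr
      _ = m'⁻¹ * b + c * (m * m')⁻¹ := by
          rw [mul_add, mul_comm c]
          congr 1
          rw [ENNReal.mul_inv (Or.inl h0) (Or.inl ht), mul_comm m⁻¹, mul_assoc, mul_left_comm m⁻¹,
            ENNReal.inv_mul_cancel h0 ht, mul_one]
  refine tvNorm_le_of_forall _ _ (fun A => ?_) fun A => ?_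
  · exact key _ _ _ _ h₁₀ (measure_ne_top _ _) h₂₀ (measure_ne_top _ _) (h₁ A)
  · rw [mul_comm (m₁ Set.univ)]
    exact key _ _ _ _ h₂₀ (measure_ne_top _ _) h₁₀ (measure_ne_top _ _) (h₂ A)

end TotalVariation

/-! ### Filtering distributions as weighted flows -/

section FilterDensity

variable {S T : Type*} [MeasurableSpace S] {Λ : Measure S} [SFinite Λ]
  {Q : Kernel S S} {q : S → S → ℝ≥0∞} {g : S → T → ℝ} {ν : Measure S} {y : ℕ → T}

lemma bind_eq_withDensity (hq : Measurable (Function.uncurry q))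
    (hQ : ∀ x, Q x = Λ.withDensity (q x)) (m : Measure S) [SFinite m] :
    m.bind Q = Λ.withDensity fun x' => ∫⁻ x, q x x' ∂m := by
  ext A hA
  rw [Measure.bind_apply hA Q.aemeasurable, withDensity_apply _ hA,
    lintegral_lintegral_swap (f := fun x' x => q x x') (hq.comp measurable_swap).aemeasurable]
  simp_rw [hQ, withDensity_apply _ hA]

lemma unnormalizedFilter_le (hQ₁ : ∀ x, Q x Set.univ ≤ 1) {B : ℝ≥0∞}
    (hB : ∀ x n, ENNReal.ofReal (g x (y n)) ≤ B) (n : ℕ) :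
    unnormalizedFilter Q g ν y n Set.univ ≤ B ^ (n + 1) * ν Set.univ := by
  have hw : ∀ (m : Measure S) n, (m.withDensity fun x => ENNReal.ofReal (g x (y n))) Set.univ ≤
      B * m Set.univ := fun m n => by
    rw [withDensity_apply _ MeasurableSet.univ, setLIntegral_univ, ← lintegral_const]
    exact lintegral_mono fun x => hB x n
  induction n with
  | zero => simpa [unnormalizedFilter] using hw ν 0
  | succ n ih =>
    refine (hw _ _).trans ?_
    rw [pow_succ' B (n + 1), mul_assoc]
    refine mul_le_mul_right (le_trans ?_ ih) _
    rw [Measure.bind_apply MeasurableSet.univ Q.aemeasurable, ← lintegral_one]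
    exact lintegral_mono fun x => hQ₁ x

/-- The density of the one-step predictor of the state at time `1`. -/
noncomputable def predictorDensity (q : S → S → ℝ≥0∞) (g : S → T → ℝ) (ν : Measure S) (y₀ : T)
    (x' : S) : ℝ≥0∞ :=
  ∫⁻ x, q x x' ∂(ν.withDensity fun x => ENNReal.ofReal (g x y₀))

/-- From time `1` on, the unnormalized filter has a density with respect to `Λ`. -/
lemma unnormalizedFilter_succ_eq_withDensity [IsFiniteMeasure ν]
    (hq : Measurable (Function.uncurry q)) (hQ : ∀ x, Q x = Λ.withDensity (q x))
    (hg : ∀ n, Measurable fun x => g x (y n)) (n : ℕ) :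
    unnormalizedFilter Q g ν y (n + 1) = Λ.withDensity
      (propagate Λ (fun _ => q) (fun n x => ENNReal.ofReal (g x (y (n + 1))))
        (predictorDensity q g ν (y 0)) n) := by
  have hgm : ∀ n, Measurable fun x => ENNReal.ofReal (g x (y n)) := fun n => (hg n).ennreal_ofReal
  have hint : ∀ m : Measure S, SFinite m → Measurable fun x' => ∫⁻ x, q x x' ∂m := fun m _ =>
    hq.lintegral_prod_left'
  induction n with
  | zero =>
    simp only [unnormalizedFilter]
    rw [bind_eq_withDensity hq hQ, ← withDensity_mul _ (hint _ inferInstance) (hgm 1)]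
    congr 1
    ext x
    simp [propagate, predictorDensity, mul_comm]
  | succ n ih =>
    rw [unnormalizedFilter, ih]
    have hp : Measurable (propagate Λ (fun _ => q) (fun n x => ENNReal.ofReal (g x (y (n + 1))))
        (predictorDensity q g ν (y 0)) n) :=
      measurable_propagate (Λ := Λ) (fun _ => hq) (fun n => hgm (n + 1))
        (hint (ν.withDensity fun x => ENNReal.ofReal (g x (y 0))) inferInstance) n
    rw [bind_eq_withDensity hq hQ, ← withDensity_mul _ (hint _ inferInstance) (hgm (n + 2))]
    congr 1
    ext x
    simp only [propagate, Pi.mul_apply]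
    rw [mul_comm, lintegral_withDensity_eq_lintegral_mul _ hp (hq.of_uncurry_right)]
    simp only [Pi.mul_apply, mul_comm]

/-- Comparison of two filters started from `ν` and `ν'`. The likelihood is small on the pairs
outside `C n ×ˢ C n` and the counted moves between these sets satisfy a local Doeblin condition
with minorizing constant `κ n`. -/
theorem tvNorm_filterDist_le {ν' : Measure S} [IsProbabilityMeasure ν] [IsProbabilityMeasure ν']
    (hq : Measurable (Function.uncurry q)) (hQ : ∀ x, Q x = Λ.withDensity (q x))
    (hQ₁ : ∀ x, Q x Set.univ ≤ 1) (hg : ∀ n, Measurable fun x => g x (y n))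
    {M : ℝ≥0∞} (hM : M ≠ ⊤) (hgM : ∀ x n, ENNReal.ofReal (g x (y n)) ≤ M)
    {C : ℕ → Set S} (hC : ∀ n, MeasurableSet (C n)) {κ : ℕ → ℝ≥0∞} (hκt : ∀ n, κ n ≠ ⊤)
    (hκ : ∀ n, ∀ z ∈ C n ×ˢ C n, ∀ z' ∈ C (n + 1) ×ˢ C (n + 1), κ n ≤ pairKernel q z z')
    {t : ℝ≥0∞} {s : ℝ} (hs₀ : 0 ≤ s) (hs₁ : s ≤ 1)
    (htC : ∀ n, ∀ x ∉ C n, t * ENNReal.ofReal (g x (y (n + 1))) ≤ M)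
    {τ : ℝ≥0∞} (hτ : 1 ≤ τ) (hτt : τ ≠ ⊤) (hτs : τ ^ 2 = t ^ s) {c : ℕ → ℕ} (hc : ∀ n, c n ≤ 1)
    (hκc : ∀ n, c n = 1 → ∀ z ∈ C n ×ˢ C n, ∀ z' ∈ C (n + 1) ×ˢ C (n + 1),
      τ * (pairKernel q z z' - κ n) ≤ pairKernel q z z') (n : ℕ)
    (h₀ : unnormalizedFilter Q g ν y (n + 1) Set.univ ≠ 0)
    (h₀' : unnormalizedFilter Q g ν' y (n + 1) Set.univ ≠ 0) :
    tvNorm (filterDist Q g ν y (n + 1)) (filterDist Q g ν' y (n + 1)) ≤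
      2 * ((τ ^ (∑ i ∈ Finset.range n, c i))⁻¹ *
        ((M ^ 2) ^ (n + 2) * (unnormalizedFilter Q g ν y (n + 1) Set.univ *
          unnormalizedFilter Q g ν' y (n + 1) Set.univ)⁻¹) ^ s) := by
  have hgm : ∀ n, Measurable fun x => ENNReal.ofReal (g x (y (n + 1))) := fun n =>
    (hg (n + 1)).ennreal_ofReal
  have hψm : ∀ ν : Measure S, IsProbabilityMeasure ν → Measurable (predictorDensity q g ν (y 0)) :=
    fun ν _ => hq.lintegral_prod_left'
  have hfin : ∀ ν : Measure S, IsProbabilityMeasure ν → ∀ n,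
      unnormalizedFilter Q g ν y n Set.univ < ⊤ := fun ν _ n =>
    (unnormalizedFilter_le hQ₁ hgM n).trans_lt
      (ENNReal.mul_lt_top (ENNReal.pow_lt_top hM.lt_top) (measure_lt_top _ _))
  have hψM : ∀ ν : Measure S, IsProbabilityMeasure ν →
      ∫⁻ x, predictorDensity q g ν (y 0) x ∂Λ ≤ M := fun ν _ => by
    have h1 : (unnormalizedFilter Q g ν y 0).bind Q Set.univ =
        ∫⁻ x, predictorDensity q g ν (y 0) x ∂Λ := by
      simp only [unnormalizedFilter]
      rw [bind_eq_withDensity hq hQ, withDensity_apply _ MeasurableSet.univ, setLIntegral_univ]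
      rfl
    rw [← h1, Measure.bind_apply MeasurableSet.univ Q.aemeasurable]
    calc _ ≤ ∫⁻ x, 1 ∂(unnormalizedFilter Q g ν y 0) := lintegral_mono fun x => hQ₁ x
      _ ≤ M := by
        rw [lintegral_one]
        simpa using unnormalizedFilter_le (ν := ν) hQ₁ hgM 0
  have hq₁ : ∀ x, ∫⁻ x', q x x' ∂Λ ≤ 1 := fun x => by
    simpa [hQ, withDensity_apply _ MeasurableSet.univ] using hQ₁ x
  have hmass : ∀ ν : Measure S, IsProbabilityMeasure ν → ∀ A : Set S,
      unnormalizedFilter Q g ν y (n + 1) A = ∫⁻ x in A, propagate Λ (fun _ => q)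
        (fun n x => ENNReal.ofReal (g x (y (n + 1)))) (predictorDensity q g ν (y 0)) n x ∂Λ :=
    fun ν _ A => by
      rw [unnormalizedFilter_succ_eq_withDensity hq hQ hg, withDensity_apply']
  have htM : ∀ n z, t ^ badPair (C n) z * tensor (fun x => ENNReal.ofReal (g x (y (n + 1))))
      (fun x => ENNReal.ofReal (g x (y (n + 1)))) z ≤ M ^ 2 := by
    intro n z
    have hle : ∀ x, ENNReal.ofReal (g x (y (n + 1))) ≤ M := fun x => hgM x _
    rw [sq]
    by_cases hz : z ∈ C n ×ˢ C n
    · have hb : badPair (C n) z = 0 := by simp [badPair, hz]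
      rw [hb, pow_zero, one_mul]
      exact mul_le_mul' (hle _) (hle _)
    · have hb : badPair (C n) z = 1 := by simp [badPair, hz]
      rw [hb, pow_one, tensor]
      by_cases h1 : z.1 ∈ C n
      · have h2 : z.2 ∉ C n := fun h2 => hz ⟨h1, h2⟩
        rw [mul_left_comm]
        exact mul_le_mul' (hle _) (htC n _ h2)
      · rw [← mul_assoc]
        exact mul_le_mul' (htC n _ h1) (hle _)
  have : IsFiniteMeasure (unnormalizedFilter Q g ν y (n + 1)) := ⟨hfin ν inferInstance _⟩
  have : IsFiniteMeasure (unnormalizedFilter Q g ν' y (n + 1)) := ⟨hfin ν' inferInstance _⟩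
  have hψt : ∀ ν : Measure S, IsProbabilityMeasure ν →
      ∫⁻ x, predictorDensity q g ν (y 0) x ∂Λ ≠ ⊤ := fun ν hν =>
    ne_top_of_le_ne_top hM (hψM ν hν)
  have hcmp := fun A => setLIntegral_propagate_mul_le hq hq₁ hgm hM (fun n x => hgM x (n + 1))
    (hψm ν inferInstance) (hψm ν' inferInstance) (hψt ν inferInstance) (hψt ν' inferInstance)
    hC hκt hκ n A
  have hres := pow_mul_lintegral_residual_le hq hq₁ hgm (hψm ν inferInstance)
    (hψm ν' inferInstance) hC (B := M ^ 2) hs₀ hs₁ htM hτ hτt hτs hc hκc n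
  simp only [← setLIntegral_univ (μ := Λ), ← hmass ν inferInstance, ← hmass ν' inferInstance]
    at hcmp hres
  have hb : ∫⁻ x in Set.univ, predictorDensity q g ν (y 0) x ∂Λ ≤ M := by
    simpa using hψM ν inferInstance
  have hb' : ∫⁻ x in Set.univ, predictorDensity q g ν' (y 0) x ∂Λ ≤ M := by
    simpa using hψM ν' inferInstance
  refine (tvNorm_normalizedMeasure_le _ _ h₀ h₀' (fun A => (hcmp A).1) fun A => (hcmp A).2).trans ?_
  refine mul_le_mul_right ?_ 2
  set a := ∫⁻ z, propagate (Λ.prod Λ) (residualKernel q C κ)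
    (fun n => tensor (fun x => ENNReal.ofReal (g x (y (n + 1)))) fun x =>
      ENNReal.ofReal (g x (y (n + 1))))
    (tensor (predictorDensity q g ν (y 0)) (predictorDensity q g ν' (y 0))) n z ∂(Λ.prod Λ)
  set m := unnormalizedFilter Q g ν y (n + 1) Set.univ *
    unnormalizedFilter Q g ν' y (n + 1) Set.univ with hm
  have hm0 : m ≠ 0 := mul_ne_zero h₀ h₀'
  have hmt : m ≠ ⊤ := ENNReal.mul_ne_top (measure_ne_top _ _) (measure_ne_top _ _)
  set W := τ ^ (∑ i ∈ Finset.range n, c i)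
  have hW0 : W ≠ 0 := pow_ne_zero _ (zero_lt_one.trans_le hτ).ne'
  have hWt : W ≠ ⊤ := ENNReal.pow_ne_top hτt
  have hX : (M ^ 2) ^ (n + 1) * ((∫⁻ x in Set.univ, predictorDensity q g ν (y 0) x ∂Λ) *
      ∫⁻ x in Set.univ, predictorDensity q g ν' (y 0) x ∂Λ) ≤ (M ^ 2) ^ (n + 2) := by
    rw [pow_succ _ (n + 1)]
    gcongr
    rw [sq]
    gcongr
  calc a * m⁻¹ = W⁻¹ * (W * a) * m⁻¹ := by
        rw [← mul_assoc, ENNReal.inv_mul_cancel hW0 hWt, one_mul]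
    _ ≤ W⁻¹ * (m ^ (1 - s) * ((M ^ 2) ^ (n + 2)) ^ s) * m⁻¹ := by
        gcongr W⁻¹ * ?_ * m⁻¹
        refine hres.trans ?_
        gcongr
    _ = W⁻¹ * ((M ^ 2) ^ (n + 2) * m⁻¹) ^ s := by
        have : m ^ (1 - s) * m⁻¹ = m⁻¹ ^ s := by
          rw [← ENNReal.rpow_neg_one, ← ENNReal.rpow_add _ _ hm0 hmt, ← ENNReal.rpow_mul]
          congr 1
          ring
        rw [ENNReal.mul_rpow_of_nonneg _ _ hs₀, ← this]
        ring

omit [SFinite Λ] in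
/-- Lower bound for the mass that the filter keeps in the sets `D n` (at time `n + 1`), when a
local Doeblin condition holds between them. -/
lemma le_unnormalizedFilter_succ (hQ : ∀ x, Q x = Λ.withDensity (q x))
    (hg : ∀ n, Measurable fun x => g x (y n))
    {D : ℕ → Set S} (hD : ∀ n, MeasurableSet (D n)) {κ : ℕ → ℝ≥0∞}
    (hκ : ∀ n, ∀ x ∈ D n, ∀ x' ∈ D (n + 1), κ n ≤ q x x') {c ℓ : ℝ≥0∞}
    (hc : ∀ n, ∀ x ∈ D n, c ≤ ENNReal.ofReal (g x (y (n + 1)))) (hℓ : ∀ n, ℓ ≤ Λ (D n)) (n : ℕ) :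
    c * (∫⁻ x, ENNReal.ofReal (g x (y 0)) * Q x (D 0) ∂ν) * ∏ i ∈ Finset.range n, (c * ℓ * κ i) ≤
      unnormalizedFilter Q g ν y (n + 1) (D n) := by
  have hw : ∀ n, ∀ m : Measure S, c * m (D n) ≤
      (m.withDensity fun x => ENNReal.ofReal (g x (y (n + 1)))) (D n) := fun n m => by
    rw [withDensity_apply _ (hD n), ← setLIntegral_const]
    exact setLIntegral_mono' (hD n) (hc n)
  induction n with
  | zero =>
    rw [Finset.range_zero, Finset.prod_empty, mul_one, unnormalizedFilter]
    refine le_trans ?_ (hw 0 _)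
    gcongr
    rw [Measure.bind_apply (hD 0) Q.aemeasurable, unnormalizedFilter,
      lintegral_withDensity_eq_lintegral_mul _ (hg 0).ennreal_ofReal (Q.measurable_coe (hD 0))]
    rfl
  | succ n ih =>
    rw [Finset.prod_range_succ, ← mul_assoc, unnormalizedFilter]
    refine le_trans ?_ (hw (n + 1) _)
    rw [Measure.bind_apply (hD _) Q.aemeasurable]
    calc _ ≤ unnormalizedFilter Q g ν y (n + 1) (D n) * (c * ℓ * κ n) := by gcongr
      _ = c * (∫⁻ _ in D n, κ n * ℓ ∂(unnormalizedFilter Q g ν y (n + 1))) := by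
          rw [setLIntegral_const]; ring
      _ ≤ c * ∫⁻ x in D n, Q x (D (n + 1)) ∂(unnormalizedFilter Q g ν y (n + 1)) := by
          gcongr c * ?_
          refine setLIntegral_mono' (hD n) fun x hx => ?_
          rw [hQ, withDensity_apply _ (hD _)]
          calc κ n * ℓ ≤ κ n * Λ (D (n + 1)) := by gcongr; exact hℓ _
            _ = ∫⁻ _ in D (n + 1), κ n ∂Λ := by rw [setLIntegral_const]
            _ ≤ _ := setLIntegral_mono' (hD _) fun x' hx' => hκ n x hx x' hx'
      _ ≤ _ := by gcongr; exact Measure.restrict_le_self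

end FilterDensity

/-! ### Independence of the noise blocks -/

section Noise

variable {d p : ℕ} {Ω : Type*} [MeasurableSpace Ω] {P : Measure Ω}
  {γ : EuclideanSpace ℝ (Fin d) → ℝ} {v : EuclideanSpace ℝ (Fin p) → ℝ}
  {ζ : ℕ → Ω → EuclideanSpace ℝ (Fin d)} {ε : ℕ → Ω → EuclideanSpace ℝ (Fin p)}

/-- The σ-algebras generated by the single noise variables: `Sum.inl k` for `ζ k` and `Sum.inr k`
for `ε k`. -/
abbrev noiseSigma (ζ : ℕ → Ω → EuclideanSpace ℝ (Fin d)) (ε : ℕ → Ω → EuclideanSpace ℝ (Fin p)) :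
    ℕ ⊕ ℕ → MeasurableSpace Ω :=
  Sum.elim (fun k => MeasurableSpace.comap (ζ k) inferInstance)
    fun k => MeasurableSpace.comap (ε k) inferInstance

/-- The variables entering the `k`-th transition: `ε (k - 1)`, `ζ k` and `ε k`. -/
def noiseBlock (ζ : ℕ → Ω → EuclideanSpace ℝ (Fin d)) (ε : ℕ → Ω → EuclideanSpace ℝ (Fin p))
    (k : ℕ) (ω : Ω) : EuclideanSpace ℝ (Fin p) × EuclideanSpace ℝ (Fin d) ×
      EuclideanSpace ℝ (Fin p) :=
  (ε (k - 1) ω, ζ k ω, ε k ω)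

lemma noiseSigma_le (hζ : ∀ k, Measurable (ζ k)) (hε : ∀ k, Measurable (ε k)) (i : ℕ ⊕ ℕ) :
    noiseSigma ζ ε i ≤ ‹MeasurableSpace Ω› := by
  rcases i with k | k
  · exact (hζ k).comap_le
  · exact (hε k).comap_le

lemma iIndep_noiseSigma (hζ : iIndepFun ζ P) (hε : iIndepFun ε P)
    (hζε : IndepFun (fun ω k => ζ k ω) (fun ω k => ε k ω) P) : iIndep (noiseSigma ζ ε) P := by
  classical
  rw [iIndep_iff]
  intro s A hA
  have hleft : ∀ k ∈ s.toLeft, MeasurableSet[MeasurableSpace.comap (ζ k) inferInstance]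
      (A (Sum.inl k)) := fun k hk => hA _ (Finset.mem_toLeft.1 hk)
  have hright : ∀ k ∈ s.toRight, MeasurableSet[MeasurableSpace.comap (ε k) inferInstance]
      (A (Sum.inr k)) := fun k hk => hA _ (Finset.mem_toRight.1 hk)
  have h1 := (iIndepFun_iff _ _ P).1 hζ s.toLeft hleft
  have h2 := (iIndepFun_iff _ _ P).1 hε s.toRight hright
  have hcζ : ∀ k, MeasurableSpace.comap (ζ k) inferInstance ≤
      MeasurableSpace.comap (fun ω k => ζ k ω) MeasurableSpace.pi := fun k => by
    have : ζ k = (fun x : ℕ → EuclideanSpace ℝ (Fin d) => x k) ∘ fun ω k => ζ k ω := rfl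
    rw [this, ← MeasurableSpace.comap_comp]
    exact MeasurableSpace.comap_mono (measurable_pi_apply k).comap_le
  have hcε : ∀ k, MeasurableSpace.comap (ε k) inferInstance ≤
      MeasurableSpace.comap (fun ω k => ε k ω) MeasurableSpace.pi := fun k => by
    have : ε k = (fun x : ℕ → EuclideanSpace ℝ (Fin p) => x k) ∘ fun ω k => ε k ω := rfl
    rw [this, ← MeasurableSpace.comap_comp]
    exact MeasurableSpace.comap_mono (measurable_pi_apply k).comap_le
  have h3 := (Indep_iff _ _ _).1 ((IndepFun_iff_Indep _ _ _).1 hζε)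
    (⋂ k ∈ s.toLeft, A (Sum.inl k)) (⋂ k ∈ s.toRight, A (Sum.inr k))
    (Finset.measurableSet_biInter _ fun k hk => hcζ k _ (hleft k hk))
    (Finset.measurableSet_biInter _ fun k hk => hcε k _ (hright k hk))
  have hset : ⋂ i ∈ s, A i =
      (⋂ k ∈ s.toLeft, A (Sum.inl k)) ∩ ⋂ k ∈ s.toRight, A (Sum.inr k) := by
    ext ω
    simp
  rw [hset, h3, h1, h2]
  conv_rhs => rw [← Finset.toLeft_disjSum_toRight (u := s), Finset.prod_disjSum]

/-- The indices of the noise variables in `noiseBlock ζ ε k`. -/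
def blockIndex (k : ℕ) : Set (ℕ ⊕ ℕ) := {Sum.inr (k - 1), Sum.inl k, Sum.inr k}

omit [MeasurableSpace Ω] in
lemma measurable_noiseBlock_iSup {I : Set (ℕ ⊕ ℕ)} {k : ℕ} (hk : blockIndex k ⊆ I) :
    Measurable[⨆ i ∈ I, noiseSigma ζ ε i] (noiseBlock ζ ε k) := by
  have hle : ∀ i ∈ I, noiseSigma ζ ε i ≤ ⨆ i ∈ I, noiseSigma ζ ε i := fun i hi =>
    le_biSup (noiseSigma ζ ε) hi
  have h1 := (comap_measurable (ε (k - 1))).mono (hle (Sum.inr (k - 1)) (hk (by simp [blockIndex]))) le_rfl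
  have h2 := (comap_measurable (ζ k)).mono (hle (Sum.inl k) (hk (by simp [blockIndex]))) le_rfl
  have h3 := (comap_measurable (ε k)).mono (hle (Sum.inr k) (hk (by simp [blockIndex]))) le_rfl
  exact h1.prodMk (h2.prodMk h3)

lemma blockIndex_disjoint {j k : ℕ} (hj : 1 ≤ j) (hk : 1 ≤ k) (hjk : j ≠ k)
    (hpar : j % 2 = k % 2) : Disjoint (blockIndex j) (blockIndex k) := by
  rw [Set.disjoint_left]
  intro i hi hi'
  simp only [blockIndex, Set.mem_insert_iff, Set.mem_singleton_iff] at hi hi'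
  rcases hi with rfl | rfl | rfl <;> simp at hi' <;> omega

/-- Blocks of the same parity share no noise variable, so expectations of products over them
factorize. -/
lemma lintegral_prod_noiseBlock (hζm : ∀ k, Measurable (ζ k)) (hεm : ∀ k, Measurable (ε k))
    (hind : iIndep (noiseSigma ζ ε) P)
    {W : EuclideanSpace ℝ (Fin p) × EuclideanSpace ℝ (Fin d) × EuclideanSpace ℝ (Fin p) → ℝ≥0∞}
    (hW : Measurable W) (s : Finset ℕ) (hs : ∀ k ∈ s, 1 ≤ k)
    (hpar : ∀ j ∈ s, ∀ k ∈ s, j % 2 = k % 2) :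
    ∫⁻ ω, ∏ k ∈ s, W (noiseBlock ζ ε k ω) ∂P = ∏ k ∈ s, ∫⁻ ω, W (noiseBlock ζ ε k ω) ∂P := by
  classical
  have : IsProbabilityMeasure P := hind.isProbabilityMeasure
  induction s using Finset.cons_induction with
  | empty => simp
  | cons j s hj ih =>
    rw [Finset.prod_cons, ← ih (fun k hk => hs k (Finset.mem_cons_of_mem hk))
      (fun i hi k hk => hpar i (Finset.mem_cons_of_mem hi) k (Finset.mem_cons_of_mem hk))]
    simp only [Finset.prod_cons]
    have hle := noiseSigma_le hζm hεm
    have hdisj : Disjoint (blockIndex j) (⋃ k ∈ s, blockIndex k) := by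
      simp only [Set.disjoint_iUnion_right]
      intro k hk
      have hmem : k ∈ Finset.cons j s hj := Finset.mem_cons_of_mem hk
      have hjmem : j ∈ Finset.cons j s hj := Finset.mem_cons_self j s
      exact blockIndex_disjoint (hs j hjmem) (hs k hmem) (fun h => hj (h ▸ hk))
        (hpar j hjmem k hmem)
    refine lintegral_mul_eq_lintegral_mul_lintegral_of_independent_measurableSpace
      (iSup₂_le fun i _ => hle i) (iSup₂_le fun i _ => hle i)
      (indep_iSup_of_disjoint hle hind hdisj) (hW.comp (measurable_noiseBlock_iSup subset_rfl)) ?_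
    exact Finset.measurable_fun_prod s fun k hk => hW.comp
      (measurable_noiseBlock_iSup (Set.subset_biUnion_of_mem (u := blockIndex) hk))

lemma map_noiseBlock (hζm : ∀ k, Measurable (ζ k)) (hεm : ∀ k, Measurable (ε k))
    (hind : iIndep (noiseSigma ζ ε) P) {k : ℕ} (hk : 1 ≤ k) :
    P.map (noiseBlock ζ ε k) =
      (P.map (ε (k - 1))).prod ((P.map (ζ k)).prod (P.map (ε k))) := by
  have : IsProbabilityMeasure P := hind.isProbabilityMeasure
  have hle := noiseSigma_le hζm hεm
  have h1 : IndepFun (ζ k) (ε k) P := by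
    have := hind.indep (i := Sum.inl k) (j := Sum.inr k) (by simp)
    exact this
  have h2 : IndepFun (ε (k - 1)) (fun ω => (ζ k ω, ε k ω)) P := by
    have hdisj : Disjoint ({Sum.inr (k - 1)} : Set (ℕ ⊕ ℕ)) {Sum.inl k, Sum.inr k} := by
      simp; omega
    have h := indep_iSup_of_disjoint hle hind hdisj
    refine indep_of_indep_of_le_left (indep_of_indep_of_le_right h ?_) ?_
    · have h1 := (comap_measurable (ζ k)).mono
        (le_biSup (noiseSigma ζ ε) (i := Sum.inl k) (s := {Sum.inl k, Sum.inr k}) (by simp)) le_rfl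
      have h2 := (comap_measurable (ε k)).mono
        (le_biSup (noiseSigma ζ ε) (i := Sum.inr k) (s := {Sum.inl k, Sum.inr k}) (by simp)) le_rfl
      exact (h1.prodMk h2).comap_le
    · exact le_biSup (noiseSigma ζ ε) (i := Sum.inr (k - 1)) (by simp)
  rw [← (indepFun_iff_map_prod_eq_prod_map_map (hζm k).aemeasurable (hεm k).aemeasurable).1 h1,
    ← (indepFun_iff_map_prod_eq_prod_map_map (hεm _).aemeasurable
      ((hζm k).prodMk (hεm k)).aemeasurable).1 h2]
  rfl

lemma measurable_noiseBlock (hζm : ∀ k, Measurable (ζ k)) (hεm : ∀ k, Measurable (ε k)) (k : ℕ) :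
    Measurable (noiseBlock ζ ε k) :=
  (hεm _).prodMk ((hζm _).prodMk (hεm _))

/-- Chernoff bound for the blocks of one parity. -/
lemma measure_le_prod_noiseBlock_le (hζ : IsIIDWithPosDensity P ζ γ)
    (hε : IsIIDWithPosDensity P ε v)
    (hζε : IndepFun (fun ω k => ζ k ω) (fun ω k => ε k ω) P)
    {W : EuclideanSpace ℝ (Fin p) × EuclideanSpace ℝ (Fin d) × EuclideanSpace ℝ (Fin p) → ℝ≥0∞}
    (hW : Measurable W) {m : ℝ≥0∞} (hm : 1 ≤ m) (hWm : ∫⁻ ω, W (noiseBlock ζ ε 1 ω) ∂P ≤ m)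
    (s : Finset ℕ) (hs : ∀ k ∈ s, 1 ≤ k) (hpar : ∀ j ∈ s, ∀ k ∈ s, j % 2 = k % 2) {n : ℕ}
    (hn : s.card ≤ n) {T : ℝ≥0∞} (hT₀ : T ≠ 0) (hT : T ≠ ⊤) :
    P {ω | T ≤ ∏ k ∈ s, W (noiseBlock ζ ε k ω)} ≤ m ^ n / T := by
  have hind := iIndep_noiseSigma hζ.indep hε.indep hζε
  have hmeas : ∀ k, Measurable fun ω => W (noiseBlock ζ ε k ω) := fun k =>
    hW.comp (measurable_noiseBlock hζ.measurable hε.measurable k)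
  refine (meas_ge_le_lintegral_div
    (Finset.measurable_fun_prod s fun k _ => hmeas k).aemeasurable hT₀ hT).trans ?_
  gcongr
  rw [lintegral_prod_noiseBlock hζ.measurable hε.measurable hind hW s hs hpar]
  have heq : ∀ k ∈ s, ∫⁻ ω, W (noiseBlock ζ ε k ω) ∂P ≤ m := fun k hk => by
    rw [← lintegral_map hW (measurable_noiseBlock hζ.measurable hε.measurable k)]
    rw [← lintegral_map hW (measurable_noiseBlock hζ.measurable hε.measurable 1)] at hWm
    rw [map_noiseBlock hζ.measurable hε.measurable hind (hs k hk), hζ.law, hε.law, hε.law]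
    rwa [map_noiseBlock hζ.measurable hε.measurable hind le_rfl, hζ.law, hε.law, hε.law] at hWm
  calc ∏ k ∈ s, ∫⁻ ω, W (noiseBlock ζ ε k ω) ∂P ≤ m ^ s.card :=
        (Finset.prod_le_prod' heq).trans (by rw [Finset.prod_const])
    _ ≤ m ^ n := pow_le_pow_right₀ hm hn

end Noise

/-! ### Exponential rates -/

section Rate

/-- An exponential bound forces a negative rate. -/
lemma limsup_log_lt_zero {u : ℕ → ℝ≥0∞} {C r : ℝ≥0∞} (hC : C ≠ ⊤) (hr : r < 1)
    (hu : ∀ᶠ n in atTop, u n ≤ C * r ^ n) :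
    limsup (fun n : ℕ => ((n : ℝ) : EReal)⁻¹ * ENNReal.log (u n)) atTop < 0 := by
  obtain ⟨r', hr', hr'1⟩ := exists_between hr
  have hr'0 : r' ≠ 0 := (zero_le.trans_lt hr').ne'
  have hr't : r' ≠ ⊤ := (hr'1.trans ENNReal.one_lt_top).ne
  have hlim : Tendsto (fun n : ℕ => C * (r / r') ^ n) atTop (𝓝 0) := by
    have h1 : r / r' < 1 := by
      rw [ENNReal.div_lt_iff (Or.inl hr'0) (Or.inl hr't), one_mul]; exact hr'
    simpa using ENNReal.Tendsto.const_mul (ENNReal.tendsto_pow_atTop_nhds_zero_of_lt_one h1)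
      (Or.inr hC)
  have hev : ∀ᶠ n in atTop, u n ≤ r' ^ n := by
    filter_upwards [hu, hlim.eventually (eventually_le_nhds zero_lt_one)] with n h1 h2
    calc u n ≤ C * r ^ n := h1
      _ = C * (r / r') ^ n * r' ^ n := by
          rw [mul_assoc, ← mul_pow, ENNReal.div_mul_cancel hr'0 hr't]
      _ ≤ 1 * r' ^ n := by gcongr
      _ = r' ^ n := one_mul _
  have hlog : ENNReal.log r' < 0 := ENNReal.log_lt_zero_iff.2 hr'1
  refine lt_of_le_of_lt ?_ hlog
  refine limsup_le_of_le (h := ?_)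
  filter_upwards [hev, eventually_gt_atTop 0] with n h1 hn
  have hn0 : (0 : EReal) ≤ ((n : ℝ) : EReal)⁻¹ := EReal.inv_nonneg_of_nonneg (by positivity)
  calc ((n : ℝ) : EReal)⁻¹ * ENNReal.log (u n) ≤ ((n : ℝ) : EReal)⁻¹ * ENNReal.log (r' ^ n) :=
        mul_le_mul_of_nonneg_left (ENNReal.log_monotone h1) hn0
    _ = ENNReal.log r' := by
        rw [ENNReal.log_pow, ← mul_assoc]
        have : ((n : ℝ) : EReal)⁻¹ * (n : EReal) = 1 := by
          rw [← EReal.coe_inv, ← EReal.coe_natCast, ← EReal.coe_mul,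
            inv_mul_cancel₀ (by positivity), EReal.coe_one]
        rw [this, one_mul]

end Rate

/-! ### The state-space model on a good event -/

section Model

variable {d p : ℕ} {f : EuclideanSpace ℝ (Fin d) → EuclideanSpace ℝ (Fin d)}
  {h : EuclideanSpace ℝ (Fin d) → EuclideanSpace ℝ (Fin p)}
  {γ : EuclideanSpace ℝ (Fin d) → ℝ} {v : EuclideanSpace ℝ (Fin p) → ℝ} {a b₀ b : ℝ}

/-- The transition density of the state with respect to Lebesgue measure. -/
noncomputable def stateDensity (f : EuclideanSpace ℝ (Fin d) → EuclideanSpace ℝ (Fin d))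
    (γ : EuclideanSpace ℝ (Fin d) → ℝ) (x x' : EuclideanSpace ℝ (Fin d)) : ℝ≥0∞ :=
  ENNReal.ofReal (γ (x' - f x))

lemma AssumptionE1.continuous_f (hE1 : AssumptionE1 f h a b₀ b) : Continuous f := by
  refine LipschitzWith.continuous (K := a.toNNReal) (LipschitzWith.of_dist_le_mul fun x y => ?_)
  rw [dist_eq_norm, dist_eq_norm]
  exact (hE1.lipschitz x y).trans
    (mul_le_mul_of_nonneg_right (Real.le_coe_toNNReal a) (norm_nonneg _))

lemma measurable_stateDensity (hf : Measurable f) (hγ : Measurable γ) :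
    Measurable (Function.uncurry (stateDensity f γ)) :=
  (hγ.comp (measurable_snd.sub (hf.comp measurable_fst))).ennreal_ofReal

lemma stateKernel_eq_withDensity (hf : Measurable f) (hγ : Measurable γ)
    (x : EuclideanSpace ℝ (Fin d)) :
    stateKernel f γ x = volume.withDensity (stateDensity f γ x) := by
  change Kernel.withDensity (Kernel.const _ volume) (stateDensity f γ) x = _
  rw [Kernel.withDensity_apply _ (measurable_stateDensity hf hγ), Kernel.const_apply]

lemma stateKernel_univ_le_one (hf : Measurable f) (hγ : Measurable γ)
    (hγ₁ : ∫⁻ u, ENNReal.ofReal (γ u) ≤ 1) (x : EuclideanSpace ℝ (Fin d)) :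
    stateKernel f γ x Set.univ ≤ 1 := by
  rw [stateKernel_eq_withDensity hf hγ, withDensity_apply _ MeasurableSet.univ, setLIntegral_univ]
  refine le_trans (le_of_eq ?_) hγ₁
  exact lintegral_sub_right_eq_self (fun u => ENNReal.ofReal (γ u)) (f x)

lemma measurableSet_ldSet (hh : Continuous h) (y : EuclideanSpace ℝ (Fin p)) (Δ : ℝ) :
    MeasurableSet (ldSet h y Δ) :=
  (isClosed_le (hh.sub continuous_const).norm continuous_const).measurableSet

/-- By uniform continuity of `h`, the sets `C(y, Δ)` contain balls of a common radius. -/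
lemma AssumptionE1.exists_le_volume_ldSet (hE1 : AssumptionE1 f h a b₀ b) {Δ : ℝ} (hΔ : 0 < Δ) :
    ∃ ℓ : ℝ≥0∞, ℓ ≠ 0 ∧ ∀ y, ℓ ≤ volume (ldSet h y Δ) := by
  obtain ⟨δ, hδ, hδΔ⟩ := Metric.uniformContinuous_iff.1 hE1.uniformContinuous Δ hΔ
  refine ⟨volume (Metric.ball (0 : EuclideanSpace ℝ (Fin d)) δ),
    (Metric.measure_ball_pos _ _ hδ).ne', fun y => ?_⟩
  obtain ⟨x₀, hx₀⟩ := hE1.surjective y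
  rw [← Measure.addHaar_ball_center volume x₀ δ]
  refine measure_mono fun x hx => ?_
  have := hδΔ (Metric.mem_ball.1 hx)
  rw [hx₀, dist_eq_norm] at this
  exact this.le

lemma AssumptionE1.nonneg (hE1 : AssumptionE1 f h a b₀ b)
    (hd : Nontrivial (EuclideanSpace ℝ (Fin d))) : 0 ≤ a ∧ 0 ≤ b₀ ∧ 0 ≤ b := by
  refine ⟨?_, ?_, ?_⟩
  · obtain ⟨x, x', hx⟩ := hd
    have h1 := (norm_nonneg _).trans (hE1.lipschitz x x')
    exact nonneg_of_mul_nonneg_left h1 (norm_pos_iff.2 (sub_ne_zero.2 hx))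
  · simpa using hE1.preimage_dist _ _ 0 0 rfl rfl
  · -- If `b < 0`, the whole space has diameter at most `b₀`.
    by_contra! hb
    obtain ⟨x, hx⟩ := NormedSpace.exists_lt_norm ℝ (EuclideanSpace ℝ (Fin d)) b₀
    have h1 := hE1.preimage_dist _ _ x 0 rfl rfl
    rw [sub_zero] at h1
    nlinarith [norm_nonneg (h x - h 0)]

/-- The argument of `γ⁻` in `Z_k^Δ`, as a function of the noise block `(ε_{k-1}, ζ_k, ε_k)`. -/
noncomputable def noiseRadius (a b₀ b Δ : ℝ)
    (e : EuclideanSpace ℝ (Fin p) × EuclideanSpace ℝ (Fin d) × EuclideanSpace ℝ (Fin p)) : ℝ :=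
  2 * (a + 1) * b₀ + (a + 1) * b * Δ + a * b * ‖e.1‖ + ‖e.2.1‖ + b * ‖e.2.2‖

lemma noiseRadius_nonneg (ha : 0 ≤ a) (hb₀ : 0 ≤ b₀) (hb : 0 ≤ b) {Δ : ℝ} (hΔ : 0 ≤ Δ)
    (e : EuclideanSpace ℝ (Fin p) × EuclideanSpace ℝ (Fin d) × EuclideanSpace ℝ (Fin p)) :
    0 ≤ noiseRadius a b₀ b Δ e := by
  unfold noiseRadius
  positivity

lemma measurable_noiseRadius (Δ : ℝ) : Measurable (noiseRadius (d := d) (p := p) a b₀ b Δ) := by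
  unfold noiseRadius
  fun_prop

lemma gammaMinus_antitone (γ : EuclideanSpace ℝ (Fin d) → ℝ) : Antitone (gammaMinus γ) :=
  fun _ _ h => biInf_mono fun _ hs => Metric.closedBall_subset_closedBall h hs

lemma gammaPlus_monotone (γ : EuclideanSpace ℝ (Fin d) → ℝ) : Monotone (gammaPlus γ) :=
  fun _ _ h => biSup_mono fun _ hs => Metric.closedBall_subset_closedBall h hs

lemma measurable_gammaMinus_noiseRadius (Δ : ℝ) :
    Measurable fun e : EuclideanSpace ℝ (Fin p) × EuclideanSpace ℝ (Fin d) ×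
      EuclideanSpace ℝ (Fin p) => gammaMinus γ (noiseRadius a b₀ b Δ e) :=
  (gammaMinus_antitone γ).measurable.comp (measurable_noiseRadius Δ)

lemma measurable_gammaPlus_noiseRadius (Δ : ℝ) :
    Measurable fun e : EuclideanSpace ℝ (Fin p) × EuclideanSpace ℝ (Fin d) ×
      EuclideanSpace ℝ (Fin p) => gammaPlus γ (noiseRadius a b₀ b Δ e) :=
  (gammaPlus_monotone γ).measurable.comp (measurable_noiseRadius Δ)

lemma gammaMinus_ne_top {r : ℝ} (hr : 0 ≤ r) : gammaMinus γ r ≠ ⊤ :=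
  ne_top_of_le_ne_top (ENNReal.ofReal_ne_top (r := γ 0)) (iInf₂_le 0 (by simpa using hr))

lemma gammaMinus_le_stateDensity {r : ℝ} {x x' : EuclideanSpace ℝ (Fin d)} (hr : ‖x' - f x‖ ≤ r) :
    gammaMinus γ r ≤ stateDensity f γ x x' :=
  iInf₂_le (x' - f x) (by simpa using hr)

lemma stateDensity_le_gammaPlus {r : ℝ} {x x' : EuclideanSpace ℝ (Fin d)} (hr : ‖x' - f x‖ ≤ r) :
    stateDensity f γ x x' ≤ gammaPlus γ r :=
  le_iSup₂ (f := fun s (_ : s ∈ Metric.closedBall (0 : EuclideanSpace ℝ (Fin d)) r) =>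
    ENNReal.ofReal (γ s)) (x' - f x) (by simpa using hr)

variable {Ω : Type*} [MeasurableSpace Ω] {P : Measure Ω}
  {ζ : ℕ → Ω → EuclideanSpace ℝ (Fin d)} {ε : ℕ → Ω → EuclideanSpace ℝ (Fin p)}
  {X : ℕ → Ω → EuclideanSpace ℝ (Fin d)} {Y : ℕ → Ω → EuclideanSpace ℝ (Fin p)}

/-- Two points of `C(Y_k, Δ)` and `C(Y_{k+1}, Δ)` are close to the true states `X_k`, `X_{k+1}`,
so the noise needed to move from one to the other is controlled by the noise of the model. -/
lemma norm_sub_le_noiseRadius (hmodel : IsStateSpaceProcess P f h γ v ζ ε X Y)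
    (hE1 : AssumptionE1 f h a b₀ b) (ha : 0 ≤ a) (hb₀ : 0 ≤ b₀) (hb : 0 ≤ b) {Δ : ℝ} {k : ℕ}
    {ω : Ω} {x x' : EuclideanSpace ℝ (Fin d)} (hx : x ∈ ldSet h (Y k ω) Δ)
    (hx' : x' ∈ ldSet h (Y (k + 1) ω) Δ) :
    ‖x' - f x‖ ≤ noiseRadius a b₀ b Δ (noiseBlock ζ ε (k + 1) ω) := by
  have hclose : ∀ j, ∀ z ∈ ldSet h (Y j ω) Δ, ‖z - X j ω‖ ≤ b₀ + b * (Δ + ‖ε j ω‖) := by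
    intro j z hz
    refine (hE1.preimage_dist _ _ z (X j ω) rfl rfl).trans ?_
    have hz' : ‖h z - Y j ω‖ ≤ Δ := hz
    have : h z - h (X j ω) = (h z - Y j ω) + ε j ω := by rw [hmodel.obs_eq]; abel
    have h2 : ‖h z - h (X j ω)‖ ≤ Δ + ‖ε j ω‖ := by
      rw [this]
      exact (norm_add_le _ _).trans (by linarith)
    gcongr
  have h1 := hclose (k + 1) x' hx'
  have h2 := hclose k x hx
  have h3 : ‖f (X k ω) - f x‖ ≤ a * (b₀ + b * (Δ + ‖ε k ω‖)) := by
    refine (hE1.lipschitz _ _).trans ?_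
    rw [norm_sub_rev]
    gcongr
  have h4 : x' - f x = (x' - X (k + 1) ω) + ζ (k + 1) ω + (f (X k ω) - f x) := by
    rw [hmodel.state_eq]; abel
  have h5 : ‖x' - f x‖ ≤ ‖x' - X (k + 1) ω‖ + ‖ζ (k + 1) ω‖ + ‖f (X k ω) - f x‖ := by
    rw [h4]
    exact norm_add₃_le
  simp only [noiseRadius, noiseBlock, Nat.add_sub_cancel]
  nlinarith [mul_nonneg ha hb₀]

/-- The indices in `[2, n + 2)` of a given parity. -/
def parityBlocks (π n : ℕ) : Finset ℕ := (Finset.Ico 2 (n + 2)).filter fun k => k % 2 = π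

lemma prod_range_eq_prod_parityBlocks {R : Type*} [CommMonoid R] (F : ℕ → R) (n : ℕ) :
    ∏ i ∈ Finset.range n, F (i + 2) =
      (∏ k ∈ parityBlocks 0 n, F k) * ∏ k ∈ parityBlocks 1 n, F k := by
  have h1 : parityBlocks 1 n = (Finset.Ico 2 (n + 2)).filter fun k => ¬ k % 2 = 0 := by
    unfold parityBlocks
    congr 1
    ext k
    omega
  rw [h1, parityBlocks, Finset.prod_filter_mul_prod_filter_not, Finset.prod_Ico_eq_prod_range]
  simp [add_comm]

/-- The noise blocks for which the local Doeblin constant `(γ⁻ / γ⁺)²` is smaller than `J⁻¹`. -/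
def badBlocks (γ : EuclideanSpace ℝ (Fin d) → ℝ) (a b₀ b Δ : ℝ) (J : ℕ) :
    Set (EuclideanSpace ℝ (Fin p) × EuclideanSpace ℝ (Fin d) × EuclideanSpace ℝ (Fin p)) :=
  {e | J * gammaMinus γ (noiseRadius a b₀ b Δ e) ^ 2 < gammaPlus γ (noiseRadius a b₀ b Δ e) ^ 2}

/-- Outside of an exceptional event, the filters merge at a geometric rate. The sets `C(y, Δ)` bound
the normalizing constants from below; the larger sets `C(y, Δ')` are used for the coupling. -/
theorem tvNorm_filterDist_le_of_good (hmodel : IsStateSpaceProcess P f h γ v ζ ε X Y)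
    [IsProbabilityMeasure P] (hE1 : AssumptionE1 f h a b₀ b)
    (ha : 0 ≤ a) (hb₀ : 0 ≤ b₀) (hb : 0 ≤ b)
    {ν ν' : Measure (EuclideanSpace ℝ (Fin d))} [IsProbabilityMeasure ν] [IsProbabilityMeasure ν']
    {Δ Δ' : ℝ} (hΔ' : 0 ≤ Δ') {M c ℓ D L : ℝ≥0∞} {s : ℝ} {J : ℕ}
    (hM₁ : 1 ≤ M) (hM : M ≠ ⊤) (hvM : ∀ u, ENNReal.ofReal (v u) ≤ M)
    (hc₀ : c ≠ 0) (hvc : ∀ u, ‖u‖ ≤ Δ → c ≤ ENNReal.ofReal (v u))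
    (hℓ₀ : ℓ ≠ 0) (hℓ : ∀ y, ℓ ≤ volume (ldSet h y Δ)) (hD₀ : D ≠ 0)
    (hL₁ : 1 ≤ L) (hLt : L ≠ ⊤) (hL : M ^ 6 * ((min c 1 * (c * ℓ) * D ^ 3) ^ 2)⁻¹ ≤ L)
    (htail : ∀ u, Δ' < ‖u‖ → L ^ 8 * ENNReal.ofReal (v u) ≤ M)
    (hs₀ : 0 ≤ s) (hs₁ : s ≤ 1) (hJ : J ≠ 0) (hsJ : L ^ (4 * s) ≤ 1 + (J : ℝ≥0∞)⁻¹)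
    {n : ℕ} (hn : 1 ≤ n) {ω : Ω}
    (hI : D ^ n ≤ initMass f h γ v Δ ν (Y 0 ω) (Y 1 ω))
    (hI' : D ^ n ≤ initMass f h γ v Δ ν' (Y 0 ω) (Y 1 ω))
    (hG : ∀ π < 2, D ^ n ≤ ∏ k ∈ parityBlocks π n,
      gammaMinus γ (noiseRadius a b₀ b Δ (noiseBlock ζ ε k ω)))
    {cnt : ℕ → ℕ} (hcnt : ∀ i, cnt i ≤ 1)
    (hcnt_good : ∀ i, cnt i = 1 → noiseBlock ζ ε (i + 2) ω ∉ badBlocks γ a b₀ b Δ' J)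
    (hcnt_sum : n ≤ 2 * ∑ i ∈ Finset.range n, cnt i) :
    tvNorm (filterDist (stateKernel f γ) (likelihood h v) ν (fun k => Y k ω) (n + 1))
      (filterDist (stateKernel f γ) (likelihood h v) ν' (fun k => Y k ω) (n + 1)) ≤
      2 * (L ^ (-s)) ^ n := by
  have hf := hE1.continuous_f.measurable
  have hh := hE1.uniformContinuous.continuous
  have hγm := hmodel.state_noise.measurable_density
  have hvm := hmodel.obs_noise.measurable_density
  have hq := measurable_stateDensity hf hγm
  have hQ := stateKernel_eq_withDensity hf hγm
  have hγ₁ : ∫⁻ u, ENNReal.ofReal (γ u) ≤ 1 := by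
    have h1 := hmodel.state_noise.law 0
    have h2 : P.map (ζ 0) Set.univ = 1 := by
      rw [Measure.map_apply (hmodel.state_noise.measurable 0) MeasurableSet.univ]; simp
    rw [h1, withDensity_apply _ MeasurableSet.univ, setLIntegral_univ] at h2
    exact h2.le
  have hQ₁ := stateKernel_univ_le_one hf hγm hγ₁
  have hg : ∀ k, Measurable fun x => likelihood h v x (Y k ω) := fun k =>
    hvm.comp (measurable_const.sub hh.measurable)
  set G := fun k => gammaMinus γ (noiseRadius a b₀ b Δ (noiseBlock ζ ε k ω)) with hGdef
  -- lower bound for the normalizing constants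
  have hlow : ∀ μ : Measure (EuclideanSpace ℝ (Fin d)), IsProbabilityMeasure μ →
      D ^ n ≤ initMass f h γ v Δ μ (Y 0 ω) (Y 1 ω) →
      (min c 1 * (c * ℓ) * D ^ 3) ^ n ≤
        unnormalizedFilter (stateKernel f γ) (likelihood h v) μ (fun k => Y k ω) (n + 1)
          Set.univ := by
    intro μ _ hμ
    have h1 := le_unnormalizedFilter_succ (Q := stateKernel f γ) (q := stateDensity f γ)
      (g := likelihood h v) (ν := μ) (y := fun k => Y k ω) hQ hg
      (D := fun n => ldSet h (Y (n + 1) ω) Δ) (κ := fun n => G (n + 2))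
      (fun n => measurableSet_ldSet hh _ _)
      (fun n x hx x' hx' => gammaMinus_le_stateDensity
        (norm_sub_le_noiseRadius hmodel hE1 ha hb₀ hb hx hx'))
      (c := c) (ℓ := ℓ) (fun n x hx => hvc _ (by rw [norm_sub_rev]; exact hx)) (fun n => hℓ _) n
    refine le_trans ?_ (h1.trans (measure_mono (Set.subset_univ _)))
    rw [Finset.prod_mul_distrib, Finset.prod_const, Finset.card_range,
      prod_range_eq_prod_parityBlocks G]
    have h2 : min c 1 ^ n ≤ c :=
      (pow_le_of_le_one zero_le (min_le_right c 1) (by omega)).trans (min_le_left c 1)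
    calc (min c 1 * (c * ℓ) * D ^ 3) ^ n = min c 1 ^ n * D ^ n * ((c * ℓ) ^ n * (D ^ n * D ^ n)) := by
          ring
      _ ≤ _ := by
          gcongr
          · exact hμ
          · exact hG 0 (by norm_num)
          · exact hG 1 (by norm_num)
  set E := min c 1 * (c * ℓ) * D ^ 3 with hE
  have hE₀ : E ≠ 0 :=
    mul_ne_zero (mul_ne_zero (by simp [hc₀]) (mul_ne_zero hc₀ hℓ₀)) (pow_ne_zero _ hD₀)
  clear_value E
  have hm := hlow ν inferInstance hI
  have hm' := hlow ν' inferInstance hI'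
  have hrad : ∀ i, ∀ x ∈ ldSet h (Y (i + 1) ω) Δ', ∀ x' ∈ ldSet h (Y (i + 1 + 1) ω) Δ',
      ‖x' - f x‖ ≤ noiseRadius a b₀ b Δ' (noiseBlock ζ ε (i + 2) ω) := fun i x hx x' hx' =>
    norm_sub_le_noiseRadius hmodel hE1 ha hb₀ hb hx hx'
  set G' := fun i => gammaMinus γ (noiseRadius a b₀ b Δ' (noiseBlock ζ ε (i + 2) ω)) with hG'
  have hκ : ∀ i, ∀ z ∈ ldSet h (Y (i + 1) ω) Δ' ×ˢ ldSet h (Y (i + 1) ω) Δ',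
      ∀ z' ∈ ldSet h (Y (i + 1 + 1) ω) Δ' ×ˢ ldSet h (Y (i + 1 + 1) ω) Δ',
      G' i ^ 2 ≤ pairKernel (stateDensity f γ) z z' := fun i z hz z' hz' => by
    rw [sq]
    exact mul_le_mul' (gammaMinus_le_stateDensity (hrad i _ hz.1 _ hz'.1))
      (gammaMinus_le_stateDensity (hrad i _ hz.2 _ hz'.2))
  have hκt : ∀ i, G' i ^ 2 ≠ ⊤ := fun i =>
    ENNReal.pow_ne_top (gammaMinus_ne_top (noiseRadius_nonneg ha hb₀ hb hΔ' _))
  have h4s : 0 ≤ 4 * s := by linarith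
  have hL0 : L ≠ 0 := (zero_lt_one.trans_le hL₁).ne'
  have hτ₁ : 1 ≤ L ^ (4 * s) := by
    rw [← ENNReal.one_rpow (4 * s)]
    exact ENNReal.rpow_le_rpow hL₁ h4s
  have hmain := tvNorm_filterDist_le (Q := stateKernel f γ) (q := stateDensity f γ)
    (g := likelihood h v) (ν := ν) (ν' := ν') (y := fun k => Y k ω) (M := M)
    (C := fun n => ldSet h (Y (n + 1) ω) Δ') (κ := fun i => G' i ^ 2) (t := L ^ 8) (s := s)
    (τ := L ^ (4 * s)) (c := cnt) hq hQ hQ₁ hg hM (fun x k => hvM _)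
    (fun n => measurableSet_ldSet hh _ _) hκt hκ hs₀ hs₁
    (fun k x hx => htail _ (by
      have : ¬ ‖h x - Y (k + 1) ω‖ ≤ Δ' := hx
      rw [norm_sub_rev]; exact not_le.1 this))
    hτ₁ (ENNReal.rpow_ne_top_of_nonneg h4s hLt)
    (by
      rw [← ENNReal.rpow_natCast, ← ENNReal.rpow_natCast, ← ENNReal.rpow_mul, ← ENNReal.rpow_mul]
      congr 1; push_cast; ring)
    hcnt
    (fun i hi z hz z' hz' => by
      have hgood := hcnt_good i hi
      simp only [badBlocks, Set.mem_ofPred_eq, not_lt] at hgood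
      have hup : pairKernel (stateDensity f γ) z z' ≤ J * G' i ^ 2 := by
        refine le_trans ?_ hgood
        rw [sq]
        exact mul_le_mul' (stateDensity_le_gammaPlus (hrad i _ hz.1 _ hz'.1))
          (stateDensity_le_gammaPlus (hrad i _ hz.2 _ hz'.2))
      have hJt : (J : ℝ≥0∞) ≠ ⊤ := ENNReal.natCast_ne_top J
      have hJ0 : (J : ℝ≥0∞) ≠ 0 := by exact_mod_cast hJ
      calc L ^ (4 * s) * (pairKernel (stateDensity f γ) z z' - G' i ^ 2)
          ≤ (1 + (J : ℝ≥0∞)⁻¹) * (pairKernel (stateDensity f γ) z z' - G' i ^ 2) := by gcongr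
        _ ≤ (pairKernel (stateDensity f γ) z z' - G' i ^ 2) + (J : ℝ≥0∞)⁻¹ * (J * G' i ^ 2) := by
            rw [add_mul, one_mul]
            gcongr
            exact tsub_le_self.trans hup
        _ = pairKernel (stateDensity f γ) z z' := by
            rw [← mul_assoc, ENNReal.inv_mul_cancel hJ0 hJt, one_mul]
            exact tsub_add_cancel_of_le (hκ i z hz z' hz'))
    n (ne_of_gt ((pos_iff_ne_zero.2 (pow_ne_zero n hE₀)).trans_le hm))
    (ne_of_gt ((pos_iff_ne_zero.2 (pow_ne_zero n hE₀)).trans_le hm'))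
  refine hmain.trans (mul_le_mul_right ?_ 2)
  set S := ∑ i ∈ Finset.range n, cnt i
  have hratio : (M ^ 2) ^ (n + 2) * (unnormalizedFilter (stateKernel f γ) (likelihood h v) ν
      (fun k => Y k ω) (n + 1) Set.univ * unnormalizedFilter (stateKernel f γ) (likelihood h v) ν'
      (fun k => Y k ω) (n + 1) Set.univ)⁻¹ ≤ L ^ n := by
    calc _ ≤ (M ^ 6) ^ n * (E ^ n * E ^ n)⁻¹ := by
          refine mul_le_mul' ?_ (ENNReal.inv_le_inv.2 (mul_le_mul' hm hm'))
          rw [← pow_mul, ← pow_mul]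
          exact pow_le_pow_right₀ hM₁ (by omega)
      _ = (M ^ 6 * (E ^ 2)⁻¹) ^ n := by
          rw [mul_pow, ← sq, ← ENNReal.inv_pow, pow_right_comm E]
      _ ≤ L ^ n := by gcongr
  have hS : L ^ (2 * s * n) ≤ (L ^ (4 * s)) ^ S := by
    rw [← ENNReal.rpow_mul_natCast]
    refine ENNReal.rpow_le_rpow_of_exponent_le hL₁ ?_
    have : (n : ℝ) ≤ 2 * S := by exact_mod_cast hcnt_sum
    nlinarith
  calc ((L ^ (4 * s)) ^ S)⁻¹ * _ ≤ (L ^ (2 * s * n))⁻¹ * (L ^ n) ^ s := by gcongr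
    _ = (L ^ (-s)) ^ n := by
        rw [← ENNReal.rpow_neg, ← ENNReal.rpow_natCast, ← ENNReal.rpow_natCast,
          ← ENNReal.rpow_mul, ← ENNReal.rpow_mul, ← ENNReal.rpow_add _ _ hL0 hLt]
        congr 1
        ring

end Model

/-! ### Choice of constants -/

section Constants

lemma exists_rpow_le_one_add_inv {L : ℝ≥0∞} (hL : L ≠ ⊤) {J : ℕ} (hJ : J ≠ 0) :
    ∃ s : ℝ, 0 < s ∧ s ≤ 1 ∧ L ^ (4 * s) ≤ 1 + (J : ℝ≥0∞)⁻¹ := by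
  have hJ' : (0 : ℝ) < J := by positivity
  obtain ⟨m, hm⟩ := pow_unbounded_of_one_lt L.toReal
    (show (1 : ℝ) < 1 + (J : ℝ)⁻¹ by linarith [inv_pos.2 hJ'])
  have hcoe : ENNReal.ofReal (1 + (J : ℝ)⁻¹) = 1 + (J : ℝ≥0∞)⁻¹ := by
    rw [ENNReal.ofReal_add zero_le_one (by positivity), ENNReal.ofReal_one,
      ENNReal.ofReal_inv_of_pos hJ', ENNReal.ofReal_natCast]
  have hm' : L ≤ (1 + (J : ℝ≥0∞)⁻¹) ^ (m + 1) := by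
    calc L ≤ (1 + (J : ℝ≥0∞)⁻¹) ^ m := by
          rw [← hcoe, ← ENNReal.ofReal_pow (by positivity), ← ENNReal.ofReal_toReal hL]
          exact ENNReal.ofReal_le_ofReal hm.le
      _ ≤ _ := pow_le_pow_right₀ le_self_add (Nat.le_succ m)
  refine ⟨1 / (4 * (m + 1)), by positivity, ?_, ?_⟩
  · rw [div_le_one (by positivity)]
    have : (0 : ℝ) ≤ m := by positivity
    linarith
  · have hexp : (4 : ℝ) * (1 / (4 * (m + 1))) = ((m + 1 : ℕ) : ℝ)⁻¹ := by
      push_cast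
      field_simp
    rw [hexp]
    calc L ^ ((m + 1 : ℕ) : ℝ)⁻¹ ≤ ((1 + (J : ℝ≥0∞)⁻¹) ^ (m + 1)) ^ ((m + 1 : ℕ) : ℝ)⁻¹ :=
          ENNReal.rpow_le_rpow hm' (by positivity)
      _ = _ := by
          rw [← ENNReal.rpow_natCast, ENNReal.rpow_rpow_inv (by positivity)]

lemma exp_mul_neg_log (lam : ℝ) (x : ℝ≥0∞) :
    EReal.exp ((lam : EReal) * -ENNReal.log x) = x ^ (-lam) := by
  rw [ENNReal.rpow_eq_exp_mul_log, EReal.coe_neg, EReal.neg_mul, mul_neg]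

lemma AssumptionE2.exists_tail_le {p : ℕ} {v : EuclideanSpace ℝ (Fin p) → ℝ}
    (hE2 : AssumptionE2 v) {t : ℝ≥0∞} (ht₁ : 1 ≤ t) (ht : t ≠ ⊤) :
    ∃ Δ : ℝ, 0 < Δ ∧ ∀ u, Δ < ‖u‖ → t * ENNReal.ofReal (v u) ≤ 1 := by
  have ht0 : t ≠ 0 := (zero_lt_one.trans_le ht₁).ne'
  have htr : 0 < t⁻¹.toReal := ENNReal.toReal_pos (by simpa using ht) (by simpa using ht0)
  have h1 := hE2.tendsto_zero.eventually (eventually_le_nhds htr)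
  rw [← Metric.cobounded_eq_cocompact,
    (Metric.hasBasis_cobounded_compl_closedBall (0 : EuclideanSpace ℝ (Fin p))).eventually_iff] at h1
  obtain ⟨R, -, hR⟩ := h1
  refine ⟨max R 1, by positivity, fun u hu => ?_⟩
  have hv : v u ≤ t⁻¹.toReal := hR (by
    simp only [Set.mem_compl_iff, mem_closedBall_zero_iff, not_le]
    exact (le_max_left _ _).trans_lt hu)
  calc t * ENNReal.ofReal (v u) ≤ t * t⁻¹ := by
        gcongr
        exact (ENNReal.ofReal_le_ofReal hv).trans ENNReal.ofReal_toReal_le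
    _ = 1 := ENNReal.mul_inv_cancel ht0 ht

end Constants

/-! ### Probabilities of the exceptional events -/

section Events

variable {d p : ℕ} {f : EuclideanSpace ℝ (Fin d) → EuclideanSpace ℝ (Fin d)}
  {h : EuclideanSpace ℝ (Fin d) → EuclideanSpace ℝ (Fin p)}
  {γ : EuclideanSpace ℝ (Fin d) → ℝ} {v : EuclideanSpace ℝ (Fin p) → ℝ} {a b₀ b : ℝ}
  {Ω : Type*} [MeasurableSpace Ω] {P : Measure Ω}
  {ζ : ℕ → Ω → EuclideanSpace ℝ (Fin d)} {ε : ℕ → Ω → EuclideanSpace ℝ (Fin p)}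
  {X : ℕ → Ω → EuclideanSpace ℝ (Fin d)} {Y : ℕ → Ω → EuclideanSpace ℝ (Fin p)}

lemma IsStateSpaceProcess.measurable_obs (hmodel : IsStateSpaceProcess P f h γ v ζ ε X Y)
    (hf : Measurable f) (hh : Measurable h) (k : ℕ) : Measurable (Y k) := by
  have hX : ∀ k, Measurable (X k) := fun k => by
    induction k with
    | zero => exact hmodel.measurable_init
    | succ k ih =>
      rw [funext (hmodel.state_eq k)]
      exact (hf.comp ih).add (hmodel.state_noise.measurable _)
  rw [funext (hmodel.obs_eq k)]
  exact (hh.comp (hX k)).add (hmodel.obs_noise.measurable k)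

lemma measurable_initMass (hf : Measurable f) (hh : Continuous h) (hγ : Measurable γ)
    (hv : Measurable v) (Δ : ℝ) (ν : Measure (EuclideanSpace ℝ (Fin d))) [SFinite ν] :
    Measurable fun y : EuclideanSpace ℝ (Fin p) × EuclideanSpace ℝ (Fin p) =>
      initMass f h γ v Δ ν y.1 y.2 := by
  have hA : MeasurableSet {w : EuclideanSpace ℝ (Fin p) × EuclideanSpace ℝ (Fin d) |
      ‖h w.2 - w.1‖ ≤ Δ} :=
    (isClosed_le ((hh.comp continuous_snd).sub continuous_fst).norm
      continuous_const).measurableSet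
  have hK : Measurable fun w : EuclideanSpace ℝ (Fin p) × EuclideanSpace ℝ (Fin d) =>
      stateKernel f γ w.2 (ldSet h w.1 Δ) := by
    have : ∀ w : EuclideanSpace ℝ (Fin p) × EuclideanSpace ℝ (Fin d),
        stateKernel f γ w.2 (ldSet h w.1 Δ) = ∫⁻ x', stateDensity f γ w.2 x' *
          Set.indicator {w : EuclideanSpace ℝ (Fin p) × EuclideanSpace ℝ (Fin d) |
            ‖h w.2 - w.1‖ ≤ Δ} 1 (w.1, x') := by
      intro w
      rw [stateKernel_eq_withDensity hf hγ, withDensity_apply _ (measurableSet_ldSet hh _ _),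
        ← lintegral_indicator (measurableSet_ldSet hh _ _)]
      refine lintegral_congr fun x' => ?_
      by_cases hx : ‖h x' - w.1‖ ≤ Δ
      · rw [Set.indicator_of_mem (show x' ∈ ldSet h w.1 Δ from hx), Set.indicator_of_mem
          (show (w.1, x') ∈ {w : EuclideanSpace ℝ (Fin p) × EuclideanSpace ℝ (Fin d) |
            ‖h w.2 - w.1‖ ≤ Δ} from hx)]
        simp
      · rw [Set.indicator_of_notMem (show x' ∉ ldSet h w.1 Δ from hx),
          Set.indicator_of_notMem
          (show (w.1, x') ∉ {w : EuclideanSpace ℝ (Fin p) × EuclideanSpace ℝ (Fin d) |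
            ‖h w.2 - w.1‖ ≤ Δ} from hx), mul_zero]
    simp_rw [this]
    refine Measurable.lintegral_prod_right' (f := fun u : (EuclideanSpace ℝ (Fin p) ×
      EuclideanSpace ℝ (Fin d)) × EuclideanSpace ℝ (Fin d) => stateDensity f γ u.1.2 u.2 *
        Set.indicator {w : EuclideanSpace ℝ (Fin p) × EuclideanSpace ℝ (Fin d) |
            ‖h w.2 - w.1‖ ≤ Δ} 1 (u.1.1, u.2)) ?_
    refine ((measurable_stateDensity hf hγ).comp
      ((measurable_snd.comp measurable_fst).prodMk measurable_snd)).mul ?_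
    exact (measurable_indicator_one hA).comp
      ((measurable_fst.comp measurable_fst).prodMk measurable_snd)
  refine Measurable.lintegral_prod_right' (f := fun u : (EuclideanSpace ℝ (Fin p) ×
      EuclideanSpace ℝ (Fin p)) × EuclideanSpace ℝ (Fin d) =>
      ENNReal.ofReal (likelihood h v u.2 u.1.1) * stateKernel f γ u.2 (ldSet h u.1.2 Δ)) ?_
  have hmap : Measurable fun u : (EuclideanSpace ℝ (Fin p) × EuclideanSpace ℝ (Fin p)) ×
      EuclideanSpace ℝ (Fin d) => (u.1.2, u.2) :=
    (measurable_snd.comp measurable_fst).prodMk measurable_snd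
  refine Measurable.mul (Measurable.ennreal_ofReal (hv.comp ?_)) (hK.comp hmap)
  exact (measurable_fst.comp measurable_fst).sub (hh.measurable.comp measurable_snd)

/-- Markov's inequality for the logarithm of a random variable. -/
lemma measure_lt_pow_le_expNegLogMoment {w : Ω → ℝ≥0∞} (hw : Measurable w) {lam : ℝ}
    (hlam : 0 < lam) {D : ℝ≥0∞} (hD₀ : D ≠ 0) (hD : D ≠ ⊤) (n : ℕ) :
    P {ω | w ω < D ^ n} ≤ expNegLogMoment P w lam * (D ^ lam) ^ n := by
  have hlam' : (0 : EReal) ≤ lam := by exact_mod_cast hlam.le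
  have hT₀ : (D ^ n) ^ (-lam) ≠ 0 := by
    simp [ENNReal.rpow_eq_zero_iff, hD₀, hD]
  have hT : (D ^ n) ^ (-lam) ≠ ⊤ := by
    simp [ENNReal.rpow_eq_top_iff, hD₀, hD]
  have hmeas : Measurable fun ω => EReal.exp ((lam : EReal) * max (-ENNReal.log (w ω)) 0) := by
    refine Measurable.ereal_exp ?_
    refine Measurable.const_mul ?_ _
    exact (Measurable.max (hw.ennreal_log).neg measurable_const)
  calc P {ω | w ω < D ^ n}
      ≤ P {ω | (D ^ n) ^ (-lam) ≤ EReal.exp ((lam : EReal) * max (-ENNReal.log (w ω)) 0)} := by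
        refine measure_mono fun ω hω => ?_
        have hω' : w ω < D ^ n := hω
        calc (D ^ n) ^ (-lam) ≤ (w ω) ^ (-lam) := by
              rw [ENNReal.rpow_neg, ENNReal.rpow_neg, ENNReal.inv_le_inv]
              exact ENNReal.rpow_le_rpow hω'.le hlam.le
          _ = EReal.exp ((lam : EReal) * -ENNReal.log (w ω)) := (exp_mul_neg_log _ _).symm
          _ ≤ _ := EReal.exp_monotone (mul_le_mul_of_nonneg_left (le_max_left _ _) hlam')
    _ ≤ expNegLogMoment P w lam / (D ^ n) ^ (-lam) :=
        meas_ge_le_lintegral_div hmeas.aemeasurable hT₀ hT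
    _ = _ := by
        rw [div_eq_mul_inv, ENNReal.rpow_neg, inv_inv, ← ENNReal.rpow_natCast,
          ← ENNReal.rpow_natCast, ← ENNReal.rpow_mul, ← ENNReal.rpow_mul, mul_comm lam]

/-- A finite exponential moment of `Z_1^Δ`, in terms of `γ⁻`. -/
lemma exists_lintegral_gammaMinus_rpow_lt_top {Δ : ℝ}
    (hZ : ∃ τ : ℝ, 0 < τ ∧ ∀ lam : ℝ, 0 ≤ lam → lam < τ →
      logMGF P (noiseZ γ a b₀ b ζ ε Δ 1) lam ≠ ⊤ ∧ logMGF P (noiseZ γ a b₀ b ζ ε Δ 1) lam ≠ ⊥) :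
    ∃ lam : ℝ, 0 < lam ∧
      ∫⁻ ω, gammaMinus γ (noiseRadius a b₀ b Δ (noiseBlock ζ ε 1 ω)) ^ (-lam) ∂P < ⊤ := by
  obtain ⟨τ, hτ, hfin⟩ := hZ
  refine ⟨τ / 2, half_pos hτ, ?_⟩
  have h1 := (hfin (τ / 2) (half_pos hτ).le (half_lt_self hτ)).1
  rw [logMGF, Ne, ENNReal.log_eq_top_iff] at h1
  refine lt_top_iff_ne_top.2 fun h2 => h1 ?_
  rw [← h2]
  refine lintegral_congr fun ω => ?_
  rw [← exp_mul_neg_log]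
  rfl

lemma parityBlocks_spec (π n : ℕ) : (∀ k ∈ parityBlocks π n, 1 ≤ k) ∧
    (∀ j ∈ parityBlocks π n, ∀ k ∈ parityBlocks π n, j % 2 = k % 2) ∧
    (parityBlocks π n).card ≤ n := by
  simp only [parityBlocks, Finset.mem_filter, Finset.mem_Ico]
  refine ⟨fun k hk => by omega, fun j hj k hk => by omega, ?_⟩
  exact (Finset.card_filter_le _ _).trans (by simp)

lemma measurableSet_badBlocks (Δ : ℝ) (J : ℕ) :
    MeasurableSet (badBlocks (d := d) (p := p) γ a b₀ b Δ J) :=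
  measurableSet_lt (((measurable_gammaMinus_noiseRadius Δ).pow_const 2).const_mul _)
    ((measurable_gammaPlus_noiseRadius Δ).pow_const 2)

/-- For large `J`, bad blocks are rare. -/
lemma exists_measure_badBlocks_le [IsFiniteMeasure P] (hζ : ∀ k, Measurable (ζ k))
    (hε : ∀ k, Measurable (ε k)) (hγ : ∀ r : ℝ, gammaPlus γ r < ⊤) {Δ lam : ℝ} (hlam : 0 < lam)
    (hfin : ∫⁻ ω, gammaMinus γ (noiseRadius a b₀ b Δ (noiseBlock ζ ε 1 ω)) ^ (-lam) ∂P < ⊤)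
    {δ : ℝ≥0∞} (hδ : δ ≠ 0) :
    ∃ J : ℕ, J ≠ 0 ∧ P {ω | noiseBlock ζ ε 1 ω ∈ badBlocks γ a b₀ b Δ J} ≤ δ := by
  have hblock := measurable_noiseBlock hζ hε 1
  have hanti : Antitone fun J : ℕ => {ω | noiseBlock ζ ε 1 ω ∈ badBlocks γ a b₀ b Δ J} := by
    intro J J' hJ ω hω
    have h1 : (J' : ℝ≥0∞) * gammaMinus γ (noiseRadius a b₀ b Δ (noiseBlock ζ ε 1 ω)) ^ 2 <
      gammaPlus γ (noiseRadius a b₀ b Δ (noiseBlock ζ ε 1 ω)) ^ 2 := hω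
    refine lt_of_le_of_lt ?_ h1
    gcongr
  have hlim := tendsto_measure_iInter_atTop (μ := P)
    (fun J => (hblock (measurableSet_badBlocks (γ := γ) (a := a) (b₀ := b₀) (b := b) Δ
      J)).nullMeasurableSet) hanti ⟨0, measure_ne_top _ _⟩
  have hnull : P (⋂ J : ℕ, {ω | noiseBlock ζ ε 1 ω ∈ badBlocks γ a b₀ b Δ J}) = 0 := by
    have hae := ae_lt_top (((measurable_gammaMinus_noiseRadius Δ).comp hblock).pow_const (-lam))
      hfin.ne
    refine measure_mono_null (fun ω hω => ?_) hae
    simp only [Set.mem_iInter] at hω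
    intro (hlt : (gammaMinus γ (noiseRadius a b₀ b Δ (noiseBlock ζ ε 1 ω))) ^ (-lam) < ⊤)
    have h0 : gammaMinus γ (noiseRadius a b₀ b Δ (noiseBlock ζ ε 1 ω)) ^ 2 ≠ 0 := by
      refine pow_ne_zero 2 fun h0 => ?_
      rw [h0, ENNReal.zero_rpow_of_neg (by linarith)] at hlt
      exact lt_irrefl _ hlt
    obtain ⟨J, hJ⟩ := ENNReal.exists_nat_mul_gt h0
      (ENNReal.pow_ne_top (n := 2) (hγ (noiseRadius a b₀ b Δ (noiseBlock ζ ε 1 ω))).ne)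
    have h1 : (J : ℝ≥0∞) * gammaMinus γ (noiseRadius a b₀ b Δ (noiseBlock ζ ε 1 ω)) ^ 2 <
      gammaPlus γ (noiseRadius a b₀ b Δ (noiseBlock ζ ε 1 ω)) ^ 2 := hω J
    exact lt_asymm hJ h1
  change Tendsto (fun J : ℕ => P {ω | noiseBlock ζ ε 1 ω ∈ badBlocks γ a b₀ b Δ J}) atTop
    (𝓝 (P (⋂ J : ℕ, {ω | noiseBlock ζ ε 1 ω ∈ badBlocks γ a b₀ b Δ J}))) at hlim
  rw [hnull] at hlim
  obtain ⟨J, hJ, hJ0⟩ := ((hlim.eventually (eventually_le_nhds (pos_iff_ne_zero.2 hδ))).and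
    (eventually_ne_atTop 0)).exists
  exact ⟨J, hJ0, hJ⟩

/-- The product of `γ⁻` over one parity class is rarely exponentially small. -/
lemma measure_prod_gammaMinus_lt_le (hmodel : IsStateSpaceProcess P f h γ v ζ ε X Y)
    (ha : 0 ≤ a) (hb₀ : 0 ≤ b₀) (hb : 0 ≤ b) {Δ : ℝ} (hΔ : 0 ≤ Δ) {lam : ℝ} (hlam : 0 < lam)
    {m : ℝ≥0∞} (hm₁ : 1 ≤ m) (hm : m ≠ ⊤)
    (hWm : ∫⁻ ω, gammaMinus γ (noiseRadius a b₀ b Δ (noiseBlock ζ ε 1 ω)) ^ (-lam) ∂P ≤ m)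
    {D : ℝ≥0∞} (hD : D ^ (-lam) = 2 * m) (π n : ℕ) :
    P {ω | ∏ k ∈ parityBlocks π n, gammaMinus γ (noiseRadius a b₀ b Δ (noiseBlock ζ ε k ω)) <
      D ^ n} ≤ (2⁻¹) ^ n := by
  obtain ⟨h1, h2, h3⟩ := parityBlocks_spec π n
  have hm0 : m ≠ 0 := (zero_lt_one.trans_le hm₁).ne'
  have hT : (D ^ n) ^ (-lam) = (2 * m) ^ n := by
    rw [← hD, ← ENNReal.rpow_natCast, ← ENNReal.rpow_natCast, ← ENNReal.rpow_mul,
      ← ENNReal.rpow_mul, mul_comm]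
  have hT₀ : (2 * m) ^ n ≠ 0 := pow_ne_zero _ (mul_ne_zero two_ne_zero hm0)
  have hTt : (2 * m) ^ n ≠ ⊤ := ENNReal.pow_ne_top (ENNReal.mul_ne_top ENNReal.ofNat_ne_top hm)
  have hcher := measure_le_prod_noiseBlock_le hmodel.state_noise hmodel.obs_noise
    hmodel.indep_noise
    ((measurable_gammaMinus_noiseRadius (γ := γ) (a := a) (b₀ := b₀) (b := b) Δ).pow_const (-lam))
    hm₁ hWm (parityBlocks π n) h1 h2 h3 hT₀ hTt
  calc _ ≤ _ := measure_mono fun ω hω => ?_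
    _ ≤ m ^ n / (2 * m) ^ n := hcher
    _ = (2⁻¹) ^ n := by
      rw [mul_pow, div_eq_mul_inv, ENNReal.mul_inv (Or.inr (ENNReal.pow_ne_top hm))
        (Or.inr (pow_ne_zero _ hm0)), mul_left_comm, ENNReal.mul_inv_cancel (pow_ne_zero _ hm0)
        (ENNReal.pow_ne_top hm), mul_one, ENNReal.inv_pow]
  have hω' : ∏ k ∈ parityBlocks π n, gammaMinus γ (noiseRadius a b₀ b Δ (noiseBlock ζ ε k ω)) <
    D ^ n := hω
  change (2 * m) ^ n ≤ ∏ k ∈ parityBlocks π n,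
    gammaMinus γ (noiseRadius a b₀ b Δ (noiseBlock ζ ε k ω)) ^ (-lam)
  rw [ENNReal.prod_rpow_of_ne_top (fun k _ => gammaMinus_ne_top
    (noiseRadius_nonneg ha hb₀ hb hΔ _)), ← hT, ENNReal.rpow_neg, ENNReal.rpow_neg,
    ENNReal.inv_le_inv]
  exact ENNReal.rpow_le_rpow hω'.le hlam.le

/-- The weight `4 ^ 8` of a bad block makes the product over `n` blocks at least `4 ^ n` as soon
as one block in eight is bad. -/
noncomputable def badWeight (γ : EuclideanSpace ℝ (Fin d) → ℝ) (a b₀ b Δ : ℝ) (J : ℕ)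
    (e : EuclideanSpace ℝ (Fin p) × EuclideanSpace ℝ (Fin d) × EuclideanSpace ℝ (Fin p)) : ℝ≥0∞ :=
  (4 ^ 8) ^ ((badBlocks γ a b₀ b Δ J).indicator (fun _ => (1 : ℕ)) e)

/-- It is exponentially unlikely that one block in eight of a parity class is bad. -/
lemma measure_prod_badWeight_le (hmodel : IsStateSpaceProcess P f h γ v ζ ε X Y)
    [IsProbabilityMeasure P] {Δ : ℝ} {J : ℕ}
    (hbad : P {ω | noiseBlock ζ ε 1 ω ∈ badBlocks γ a b₀ b Δ J} ≤ (4 ^ 8)⁻¹) (π n : ℕ) :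
    P {ω | 4 ^ n ≤ ∏ k ∈ parityBlocks π n, badWeight γ a b₀ b Δ J (noiseBlock ζ ε k ω)} ≤
      (2⁻¹) ^ n := by
  obtain ⟨h1, h2, h3⟩ := parityBlocks_spec π n
  have hS := measurableSet_badBlocks (d := d) (p := p) (γ := γ) (a := a) (b₀ := b₀) (b := b) Δ J
  have hV : Measurable (badWeight (d := d) (p := p) γ a b₀ b Δ J) :=
    (measurable_from_top (f := fun j : ℕ => ((4 : ℝ≥0∞) ^ 8) ^ j)).comp
      (measurable_const.indicator hS)
  have hblock := measurable_noiseBlock hmodel.state_noise.measurable hmodel.obs_noise.measurable 1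
  have hVm : ∫⁻ ω, badWeight γ a b₀ b Δ J (noiseBlock ζ ε 1 ω) ∂P ≤ 2 := by
    have hA : MeasurableSet {ω | noiseBlock ζ ε 1 ω ∈ badBlocks γ a b₀ b Δ J} := hblock hS
    calc _ ≤ ∫⁻ ω, (1 + {ω | noiseBlock ζ ε 1 ω ∈ badBlocks γ a b₀ b Δ J}.indicator
            (fun _ => (4 : ℝ≥0∞) ^ 8) ω) ∂P := by
          refine lintegral_mono fun ω => ?_
          by_cases hω : noiseBlock ζ ε 1 ω ∈ badBlocks γ a b₀ b Δ J
          · rw [Set.indicator_of_mem (show ω ∈ {ω | noiseBlock ζ ε 1 ω ∈ badBlocks γ a b₀ b Δ J}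
              from hω), badWeight, Set.indicator_of_mem hω]
            simp
          · rw [Set.indicator_of_notMem (show ω ∉ {ω | noiseBlock ζ ε 1 ω ∈ badBlocks γ a b₀ b Δ J}
              from hω), badWeight, Set.indicator_of_notMem hω]
            simp
      _ = 1 + 4 ^ 8 * P {ω | noiseBlock ζ ε 1 ω ∈ badBlocks γ a b₀ b Δ J} := by
          rw [lintegral_add_left measurable_const, lintegral_indicator_const hA]
          simp
      _ ≤ 1 + 4 ^ 8 * (4 ^ 8)⁻¹ := by gcongr
      _ = 2 := by
          rw [ENNReal.mul_inv_cancel (by simp) (by simp)]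
          norm_num
  refine (measure_le_prod_noiseBlock_le hmodel.state_noise hmodel.obs_noise hmodel.indep_noise hV
    one_le_two hVm (parityBlocks π n) h1 h2 h3 (T := 4 ^ n) (by simp) (by simp)).trans ?_
  rw [show (4 : ℝ≥0∞) = 2 * 2 by norm_num, mul_pow, div_eq_mul_inv, ENNReal.mul_inv (by simp)
    (by simp), ← mul_assoc, ENNReal.mul_inv_cancel (by simp) (by simp), one_mul, ENNReal.inv_pow]

omit [MeasurableSpace Ω] in
/-- If few blocks of either parity are bad, at least half of all blocks are good. -/
lemma le_two_mul_sum_good {Δ : ℝ} {J n : ℕ} {ω : Ω}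
    (hω : ∀ π < 2, ∏ k ∈ parityBlocks π n, badWeight γ a b₀ b Δ J (noiseBlock ζ ε k ω) < 4 ^ n) :
    n ≤ 2 * ∑ i ∈ Finset.range n,
      ((badBlocks γ a b₀ b Δ J)ᶜ.indicator (fun _ => 1) (noiseBlock ζ ε (i + 2) ω)) := by
  set B := badBlocks (d := d) (p := p) γ a b₀ b Δ J with hB
  have h1 := ENNReal.mul_lt_mul (hω 0 (by norm_num)) (hω 1 (by norm_num))
  rw [← prod_range_eq_prod_parityBlocks fun k => badWeight γ a b₀ b Δ J (noiseBlock ζ ε k ω)] at h1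
  simp only [badWeight, ← hB] at h1
  rw [Finset.prod_pow_eq_pow_sum, ← pow_mul, ← pow_add] at h1
  have h2 : 8 * ∑ i ∈ Finset.range n, B.indicator (fun _ => (1 : ℕ)) (noiseBlock ζ ε (i + 2) ω) <
      n + n := by
    by_contra! hle
    exact absurd h1 (not_lt.2 (pow_le_pow_right₀ (by norm_num) hle))
  have h3 : ∑ i ∈ Finset.range n, B.indicator (fun _ => (1 : ℕ)) (noiseBlock ζ ε (i + 2) ω) +
      ∑ i ∈ Finset.range n, Bᶜ.indicator (fun _ => (1 : ℕ)) (noiseBlock ζ ε (i + 2) ω) = n := by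
    rw [← Finset.sum_add_distrib]
    have : ∀ i, B.indicator (fun _ => (1 : ℕ)) (noiseBlock ζ ε (i + 2) ω) +
        Bᶜ.indicator (fun _ => (1 : ℕ)) (noiseBlock ζ ε (i + 2) ω) = 1 := fun i =>
      Set.indicator_self_add_compl_apply B (fun _ => 1) (noiseBlock ζ ε (i + 2) ω)
    simp [this]
  omega

end Events

/-! ### Exponential forgetting of the initial distribution -/

theorem proposition9 {d p : ℕ} (hpd : p ≤ d)
    {Ω : Type*} [MeasurableSpace Ω] (P : Measure Ω) [IsProbabilityMeasure P]
    (f : EuclideanSpace ℝ (Fin d) → EuclideanSpace ℝ (Fin d))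
    (h : EuclideanSpace ℝ (Fin d) → EuclideanSpace ℝ (Fin p))
    (γ : EuclideanSpace ℝ (Fin d) → ℝ) (v : EuclideanSpace ℝ (Fin p) → ℝ)
    (ζ : ℕ → Ω → EuclideanSpace ℝ (Fin d)) (ε : ℕ → Ω → EuclideanSpace ℝ (Fin p))
    (X : ℕ → Ω → EuclideanSpace ℝ (Fin d)) (Y : ℕ → Ω → EuclideanSpace ℝ (Fin p))
    (hmodel : IsStateSpaceProcess P f h γ v ζ ε X Y)
    (hγ : ∀ r : ℝ, gammaPlus γ r < ⊤)
    (a b₀ b : ℝ) (hE1 : AssumptionE1 f h a b₀ b) (hE2 : AssumptionE2 v)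
    (hZ : ∀ Δ : ℝ, 0 < Δ → ∃ τ : ℝ, 0 < τ ∧ ∀ lam : ℝ, 0 ≤ lam → lam < τ →
      logMGF P (noiseZ γ a b₀ b ζ ε Δ 1) lam ≠ ⊤ ∧ logMGF P (noiseZ γ a b₀ b ζ ε Δ 1) lam ≠ ⊥)
    (ν ν' : Measure (EuclideanSpace ℝ (Fin d))) [IsProbabilityMeasure ν] [IsProbabilityMeasure ν']
    (Δ : ℝ) (hΔ : 0 < Δ) (lam : ℝ) (hlam : 0 < lam)
    (hν : expNegLogMoment P (fun ω => initMass f h γ v Δ ν (Y 0 ω) (Y 1 ω)) lam < ⊤)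
    (hν' : expNegLogMoment P (fun ω => initMass f h γ v Δ ν' (Y 0 ω) (Y 1 ω)) lam < ⊤) :
    limsup (fun n : ℕ => ((n : ℝ) : EReal)⁻¹ * ENNReal.log
      (∫⁻ ω, tvNorm
        (filterDist (stateKernel f γ) (likelihood h v) ν (fun k => Y k ω) n)
        (filterDist (stateKernel f γ) (likelihood h v) ν' (fun k => Y k ω) n) ∂P)) atTop < 0 := by
  rcases subsingleton_or_nontrivial (EuclideanSpace ℝ (Fin d)) with hd | hd
  · -- In dimension `0` the two initial laws coincide.
    have hνν' : ν = ν' := by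
      ext A _
      rcases Set.eq_empty_or_nonempty A with rfl | hA
      · simp
      · rw [Subsingleton.eq_univ_of_nonempty hA, measure_univ, measure_univ]
    subst hνν'
    refine limsup_log_lt_zero (C := 0) (r := 0) ENNReal.zero_ne_top zero_lt_one ?_
    filter_upwards with n
    refine (lintegral_mono (g := fun _ => 0) fun ω => ?_).trans (by simp)
    exact (tvNorm_le_of_forall _ _ (c := 0) (fun A => by simp) fun A => by simp).trans (by simp)
  obtain ⟨ha, hb₀, hb⟩ := hE1.nonneg hd
  have hf := hE1.continuous_f.measurable
  have hh := hE1.uniformContinuous.continuous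
  have hγm := hmodel.state_noise.measurable_density
  have hvm := hmodel.obs_noise.measurable_density
  have hζm := hmodel.state_noise.measurable
  have hεm := hmodel.obs_noise.measurable
  -- constants that depend on `Δ` only
  obtain ⟨M₀, hM₀⟩ := hE2.bounded
  set M : ENNReal := max 1 (ENNReal.ofReal M₀) with hMdef
  have hM₁ : 1 ≤ M := le_max_left _ _
  have hMt : M ≠ ⊤ := by simp [hMdef]
  have hvM : ∀ u, ENNReal.ofReal (v u) ≤ M := fun u =>
    (ENNReal.ofReal_le_ofReal (hM₀ u)).trans (le_max_right _ _)
  obtain ⟨c₀, hc₀, hvc₀⟩ := hE2.compact_pos _ (isCompact_closedBall 0 Δ)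
  set c := ENNReal.ofReal c₀ with hcdef
  have hc : c ≠ 0 := by simpa [hcdef] using hc₀
  have hvc : ∀ u, ‖u‖ ≤ Δ → c ≤ ENNReal.ofReal (v u) := fun u hu =>
    ENNReal.ofReal_le_ofReal (hvc₀ u (by simpa using hu))
  obtain ⟨ℓ, hℓ₀, hℓ⟩ := hE1.exists_le_volume_ldSet hΔ
  obtain ⟨lamZ, hlamZ, hmomZ⟩ := exists_lintegral_gammaMinus_rpow_lt_top (hZ Δ hΔ)
  set m : ENNReal := max 1 (∫⁻ ω,
    gammaMinus γ (noiseRadius a b₀ b Δ (noiseBlock ζ ε 1 ω)) ^ (-lamZ) ∂P) with hmdef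
  have hm₁ : 1 ≤ m := le_max_left _ _
  have hmt : m ≠ ⊤ := by simpa [hmdef] using hmomZ.ne
  have h2m : 1 < 2 * m := by
    calc (1 : ENNReal) < 2 * 1 := by norm_num
      _ ≤ 2 * m := by gcongr
  have h2mt : 2 * m ≠ ⊤ := ENNReal.mul_ne_top ENNReal.ofNat_ne_top hmt
  -- `D` is so small that the Chernoff bound for `∏ γ⁻ < D ^ n` is at most `2 ^ (-n)`
  set D := (2 * m) ^ (-(1 / lamZ)) with hDdef
  have hDlam : D ^ (-lamZ) = 2 * m := by
    rw [hDdef, ← ENNReal.rpow_mul, show -(1 / lamZ) * -lamZ = 1 by field_simp, ENNReal.rpow_one]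
  have hD₀ : D ≠ 0 := by
    simp only [hDdef, Ne, ENNReal.rpow_eq_zero_iff, not_or, not_and, not_lt]
    exact ⟨fun h0 => absurd h0 (zero_lt_one.trans h2m).ne', fun h0 => absurd h0 h2mt⟩
  have hD₁ : D < 1 := by
    have hpos : 0 < 1 / lamZ := by positivity
    rw [hDdef, ENNReal.rpow_neg]
    exact ENNReal.inv_lt_one.2 (ENNReal.one_lt_rpow h2m hpos)
  have hDt : D ≠ ⊤ := (hD₁.trans ENNReal.one_lt_top).ne
  set E := min c 1 * (c * ℓ) * D ^ 3 with hEdef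
  have hE₀ : E ≠ 0 :=
    mul_ne_zero (mul_ne_zero (by simp [hc]) (mul_ne_zero hc hℓ₀)) (pow_ne_zero _ hD₀)
  set L : ENNReal := max 2 (M ^ 6 * (E ^ 2)⁻¹) with hLdef
  have hL₁ : 1 < L := ENNReal.one_lt_two.trans_le (le_max_left _ _)
  have hLt : L ≠ ⊤ := by
    have : M ^ 6 * (E ^ 2)⁻¹ ≠ ⊤ := ENNReal.mul_ne_top (ENNReal.pow_ne_top hMt)
      (ENNReal.inv_ne_top.2 (pow_ne_zero _ hE₀))
    rw [hLdef]
    exact (max_lt ENNReal.ofNat_lt_top this.lt_top).ne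
  -- constants of the coupling: the radius `Δ'`, then the Doeblin constant, then the rate
  obtain ⟨Δ', hΔ', htail⟩ := hE2.exists_tail_le (one_le_pow₀ hL₁.le : 1 ≤ L ^ 8)
    (ENNReal.pow_ne_top hLt)
  obtain ⟨lamZ', hlamZ', hmomZ'⟩ := exists_lintegral_gammaMinus_rpow_lt_top (hZ Δ' hΔ')
  obtain ⟨J, hJ, hJbad⟩ := exists_measure_badBlocks_le (P := P) hζm hεm hγ hlamZ' hmomZ'
    (δ := (4 ^ 8)⁻¹) (by simp)
  obtain ⟨s, hs₀, hs₁, hsJ⟩ := exists_rpow_le_one_add_inv hLt hJ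
  -- the exceptional events
  have hYm := hmodel.measurable_obs hf hh.measurable
  have hIm : ∀ μ : Measure (EuclideanSpace ℝ (Fin d)), IsProbabilityMeasure μ →
      Measurable fun ω => initMass f h γ v Δ μ (Y 0 ω) (Y 1 ω) := fun μ _ =>
    (measurable_initMass hf hh hγm hvm Δ μ).comp ((hYm 0).prodMk (hYm 1))
  set A₁ : ℕ → Set Ω := fun n => {ω | initMass f h γ v Δ ν (Y 0 ω) (Y 1 ω) < D ^ n} with hA₁
  set A₂ : ℕ → Set Ω := fun n => {ω | initMass f h γ v Δ ν' (Y 0 ω) (Y 1 ω) < D ^ n} with hA₂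
  set A₃ : ℕ → ℕ → Set Ω := fun π n => {ω | ∏ k ∈ parityBlocks π n,
    gammaMinus γ (noiseRadius a b₀ b Δ (noiseBlock ζ ε k ω)) < D ^ n} with hA₃
  set A₄ : ℕ → ℕ → Set Ω := fun π n => {ω | 4 ^ n ≤ ∏ k ∈ parityBlocks π n,
    badWeight γ a b₀ b Δ' J (noiseBlock ζ ε k ω)} with hA₄
  set A : ℕ → Set Ω := fun n => A₁ n ∪ A₂ n ∪ (A₃ 0 n ∪ A₃ 1 n) ∪ (A₄ 0 n ∪ A₄ 1 n) with hA
  set K₁ := expNegLogMoment P (fun ω => initMass f h γ v Δ ν (Y 0 ω) (Y 1 ω)) lam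
  set K₂ := expNegLogMoment P (fun ω => initMass f h γ v Δ ν' (Y 0 ω) (Y 1 ω)) lam
  have hPA₁ : ∀ n, P (A₁ n) ≤ K₁ * (D ^ lam) ^ n := fun n =>
    measure_lt_pow_le_expNegLogMoment (hIm ν inferInstance) hlam hD₀ hDt n
  have hPA₂ : ∀ n, P (A₂ n) ≤ K₂ * (D ^ lam) ^ n := fun n =>
    measure_lt_pow_le_expNegLogMoment (hIm ν' inferInstance) hlam hD₀ hDt n
  have hPA₃ : ∀ π n, P (A₃ π n) ≤ (2⁻¹) ^ n := fun π n =>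
    measure_prod_gammaMinus_lt_le hmodel ha hb₀ hb hΔ.le hlamZ hm₁ hmt (le_max_right _ _) hDlam π n
  have hPA₄ : ∀ π n, P (A₄ π n) ≤ (2⁻¹) ^ n := fun π n =>
    measure_prod_badWeight_le hmodel hJbad π n
  set r : ENNReal := max (max (D ^ lam) 2⁻¹) (L ^ (-s)) with hr
  have hr₁ : r < 1 := by
    refine max_lt (max_lt (ENNReal.rpow_lt_one hD₁ hlam) (by simp)) ?_
    rw [ENNReal.rpow_neg]
    exact ENNReal.inv_lt_one.2 (ENNReal.one_lt_rpow hL₁ hs₀)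
  have hr₂ : 2⁻¹ ≤ r := (le_max_right _ _).trans (le_max_left _ _)
  have hr₀ : r ≠ 0 := ((by simp : (0 : ENNReal) < 2⁻¹).trans_le hr₂).ne'
  have hrt : r ≠ ⊤ := (hr₁.trans ENNReal.one_lt_top).ne
  have hPA : ∀ n, P (A n) ≤ (K₁ + K₂ + 4) * r ^ n := by
    intro n
    have hDr : (D ^ lam) ^ n ≤ r ^ n :=
      pow_le_pow_left' ((le_max_left _ _).trans (le_max_left _ _)) n
    have h2r : (2⁻¹) ^ n ≤ r ^ n := pow_le_pow_left' hr₂ n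
    calc P (A n) ≤ P (A₁ n) + P (A₂ n) + (P (A₃ 0 n) + P (A₃ 1 n)) + (P (A₄ 0 n) + P (A₄ 1 n)) :=
          (measure_union_le _ _).trans (add_le_add ((measure_union_le _ _).trans
            (add_le_add (measure_union_le _ _) (measure_union_le _ _))) (measure_union_le _ _))
      _ ≤ K₁ * r ^ n + K₂ * r ^ n + (r ^ n + r ^ n) + (r ^ n + r ^ n) := by
          gcongr
          · exact (hPA₁ n).trans (by gcongr)
          · exact (hPA₂ n).trans (by gcongr)
          · exact (hPA₃ 0 n).trans h2r
          · exact (hPA₃ 1 n).trans h2r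
          · exact (hPA₄ 0 n).trans h2r
          · exact (hPA₄ 1 n).trans h2r
      _ = (K₁ + K₂ + 4) * r ^ n := by ring
  have hbound : ∀ n, 1 ≤ n → ∀ ω,
      tvNorm (filterDist (stateKernel f γ) (likelihood h v) ν (fun k => Y k ω) (n + 1))
        (filterDist (stateKernel f γ) (likelihood h v) ν' (fun k => Y k ω) (n + 1)) ≤
      (A n).indicator (fun _ => 2) ω + 2 * r ^ n := by
    intro n hn ω
    by_cases hω : ω ∈ A n
    · rw [Set.indicator_of_mem hω]
      exact (tvNorm_normalizedMeasure_le_two _ _).trans le_self_add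
    · rw [Set.indicator_of_notMem hω, zero_add]
      simp only [hA, Set.mem_union, not_or] at hω
      obtain ⟨⟨⟨hω₁, hω₂⟩, hω₃, hω₃'⟩, hω₄, hω₄'⟩ := hω
      refine (tvNorm_filterDist_le_of_good hmodel hE1 ha hb₀ hb hΔ'.le hM₁ hMt hvM hc
        hvc hℓ₀ hℓ hD₀ hL₁.le hLt (le_max_right _ _) (fun u hu => (htail u hu).trans hM₁) hs₀.le hs₁
        hJ hsJ hn (not_lt.1 hω₁) (not_lt.1 hω₂) ?_
        (cnt := fun i => (badBlocks γ a b₀ b Δ' J)ᶜ.indicator (fun _ => 1)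
          (noiseBlock ζ ε (i + 2) ω)) ?_ ?_ (le_two_mul_sum_good ?_)).trans ?_
      · intro π hπ
        interval_cases π
        · exact not_lt.1 hω₃
        · exact not_lt.1 hω₃'
      · exact fun i => Set.indicator_le_self' (f := fun _ => 1) (fun _ _ => Nat.zero_le _) _
      · intro i hi hmem
        simp [hmem] at hi
      · intro π hπ
        interval_cases π
        · exact not_le.1 hω₄
        · exact not_le.1 hω₄'
      · gcongr
        exact le_max_right _ _
  refine limsup_log_lt_zero (C := (2 * (K₁ + K₂ + 4) + 2) * r⁻¹) (r := r) ?_ hr₁ ?_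
  · exact ENNReal.mul_ne_top (ENNReal.add_ne_top.2 ⟨ENNReal.mul_ne_top ENNReal.ofNat_ne_top
      (ENNReal.add_ne_top.2 ⟨ENNReal.add_ne_top.2 ⟨hν.ne, hν'.ne⟩, ENNReal.ofNat_ne_top⟩),
      ENNReal.ofNat_ne_top⟩) (ENNReal.inv_ne_top.2 hr₀)
  filter_upwards [eventually_ge_atTop 2] with N hN
  obtain ⟨n, rfl⟩ : ∃ n, N = n + 1 := ⟨N - 1, by omega⟩
  calc _ ≤ ∫⁻ ω, ((A n).indicator (fun _ => 2) ω + 2 * r ^ n) ∂P :=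
        lintegral_mono fun ω => hbound n (by omega) ω
    _ = (∫⁻ ω, (A n).indicator (fun _ => 2) ω ∂P) + 2 * r ^ n := by
        rw [lintegral_add_right _ measurable_const]
        simp
    _ ≤ 2 * P (A n) + 2 * r ^ n := by
        gcongr
        exact lintegral_indicator_const_le _ _
    _ ≤ 2 * ((K₁ + K₂ + 4) * r ^ n) + 2 * r ^ n := by
        gcongr
        exact hPA n
    _ = (2 * (K₁ + K₂ + 4) + 2) * (r⁻¹ * r) * r ^ n := by
        rw [ENNReal.inv_mul_cancel hr₀ hrt]
        ring
    _ = _ := by ring
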